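/- Let $\mathcal M$ be a smooth (finite-dimensional, Hausdorff, boundaryless) Riemannian manifold. For $q\in\mathcal M$ let $\operatorname{Exp}_q(v)=c_{q,v}(1)$ be the Riemannian exponential map, defined for those $v\in T_q\mathcal M$ whose geodesic $c_{q,v}$ (with $c_{q,v}(0)=q$, $\dot c_{q,v}(0)=v$) exists on $[0,1]$. Let $t_0<t_1$ and let $f:[t_0,t_1]\to\mathcal M$ be differentiable with $$f(t_0)=p,\quad f(t_1)=q,\quad \dot f(t_0)=v_p\in T_p\mathcal M,\quad \dot f(t_1)=v_q\in T_q\mathcal M .$$ Let $D\subseteq T_q\mathcal M$ be an open subset of the domain of $\operatorname{Exp}_q$ on which $\operatorname{Exp}_q$ is injective, with $p\in\operatorname{Exp}_q(D)$, and let $\operatorname{Log}_q=(\operatorname{Exp}_q|_D)^{-1}:\operatorname{Exp}_q(D)\to D$. Assume that $p$ and $q$ are not conjugate along the geodesic $t\mapsto\operatorname{Exp}_q(t\operatorname{Log}_q(p))$, $t\in[0,1]$, i.e. that no Jacobi field along it, other than the zero field, vanishes at both end points. Then $\operatorname{Log}_q$ is differentiable at $p$, and we set $$\Delta_p=\operatorname{Log}_q(p),\qquad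 \hat v_p=d(\operatorname{Log}_q)_p(v_p)\in T_q\mathcal M,\qquad \hat v_q=v_q ,$$ and $$a_0(t)=1-\frac{(t-t_0)^2}{(t_1-t_0)^2}+\frac{2(t-t_0)^2(t-t_1)}{(t_1-t_0)^3},\quad b_0(t)=(t-t_0)-\frac{(t-t_0)^2}{t_1-t_0}+\frac{(t-t_0)^2(t-t_1)}{(t_1-t_0)^2},\quad b_1(t)=\frac{(t-t_0)^2(t-t_1)}{(t_1-t_0)^2}.$$ Assume that $a_0(t)\Delta_p+b_0(t)\hat v_p+b_1(t)\hat v_q$ lies in the domain of $\operatorname{Exp}_q$ for all $t\in[t_0,t_1]$ (which is automatic if $\mathcal M$ is complete). Then $$c:[t_0,t_1]\to\mathcal M,\qquad c(t)=\operatorname{Exp}_q\bigl(a_0(t)\Delta_p+b_0(t)\hat v_p+b_1(t)\hat v_q\bigr)$$ is a curve of class $C^1$ that solves the Hermite interpolation problem: $c(t_0)=p$, $c(t_1)=q$, $\dot c(t_0)=v_p$, $\dot c(t_1)=v_q$. -/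

import Mathlib

open Set Filter Topology Bundle
open scoped Manifold ContDiff Bundle

noncomputable section

namespace RiemannHermite

section Geometry

variable {E : Type*} [NormedAddCommGroup E] [NormedSpace ℝ E] {M : Type*} [TopologicalSpace M]
  [ChartedSpace E M]

/-- The velocity `(γ t, γ'(t)) ∈ TM` of a curve `γ`, differentiated within the time set `s`
(one-sided derivatives at the end points of a closed interval). -/
def velocityWithin (γ : ℝ → M) (s : Set ℝ) (t : ℝ) : TangentBundle 𝓘(ℝ, E) M :=
  ⟨γ t, mfderivWithin 𝓘(ℝ, ℝ) 𝓘(ℝ, E) γ s t (1 : ℝ)⟩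

/-- The velocity vector `γ'(t) ∈ T_{γ t} M` at an interior time `t`. -/
def velocity (γ : ℝ → M) (t : ℝ) : TangentSpace 𝓘(ℝ, E) (γ t) :=
  mfderiv 𝓘(ℝ, ℝ) 𝓘(ℝ, E) γ t (1 : ℝ)

variable [IsManifold 𝓘(ℝ, E) ∞ M] [RiemannianBundle (fun x : M ↦ TangentSpace 𝓘(ℝ, E) x)]

/-- The Riemannian metric in the chart `φ` at `x₀`: for `y` in the chart image, the bilinear form
`(u, w) ↦ ⟪d(φ⁻¹)_y u, d(φ⁻¹)_y w⟫` on `E`. -/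
def metricInChart (x₀ : M) (y : E) : E →L[ℝ] E →L[ℝ] ℝ :=
  (innerSL ℝ (E := TangentSpace 𝓘(ℝ, E) ((chartAt E x₀).symm y))).bilinearComp
    (mfderiv 𝓘(ℝ, E) 𝓘(ℝ, E) (chartAt E x₀).symm y)
    (mfderiv 𝓘(ℝ, E) 𝓘(ℝ, E) (chartAt E x₀).symm y)

/-- The Christoffel symbol of the Levi-Civita connection in the chart at `x₀`: `Γ_y(u, w)` is the
vector with `g_y(Γ_y(u, w), z) = (D_u g(w, z) + D_w g(u, z) - D_z g(u, w)) / 2` for all `z`. -/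
def christoffel (x₀ : M) (y u w : E) : E :=
  (metricInChart x₀ y).inverse
    ((1 / 2 : ℝ) • (fderiv ℝ (metricInChart x₀) y u w + fderiv ℝ (metricInChart x₀) y w u
      - ((fderiv ℝ (metricInChart x₀) y).flip u).flip w))

/-- The covariant derivative `D_t V` at time `t` of a vector field `V` along the curve `γ`,
computed in the chart `φ` at `γ t` as `v'(t) + Γ(x'(t), v(t))`, where `x = φ ∘ γ` and
`v(τ) = dφ (V τ)` are the coordinate expressions of `γ` and `V`. (Mathlib identifies
`T_x M` with `E` through the chart at `x`, so this is an element of `T_{γ t} M`.) -/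
def covDerivAlong (γ : ℝ → M) (V : ∀ t, TangentSpace 𝓘(ℝ, E) (γ t)) (t : ℝ) :
    TangentSpace 𝓘(ℝ, E) (γ t) :=
  let φ : M → E := chartAt E (γ t)
  let v : ℝ → E := fun τ ↦ mfderiv 𝓘(ℝ, E) 𝓘(ℝ, E) φ (γ τ) (V τ)
  (deriv v t + christoffel (γ t) (φ (γ t)) (deriv (φ ∘ γ) t) (v t) : E)

/-- The curvature tensor `R(u, w)z`, with the sign convention
`R(X, Y)Z = ∇_X ∇_Y Z - ∇_Y ∇_X Z - ∇_[X, Y] Z`, computed in the chart at `x`. -/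
def curvature (x : M) (u w z : TangentSpace 𝓘(ℝ, E) x) : TangentSpace 𝓘(ℝ, E) x :=
  let y : E := chartAt E x x
  let Γ : E → E → E → E := christoffel x
  (fderiv ℝ (fun y' ↦ Γ y' w z) y u - fderiv ℝ (fun y' ↦ Γ y' u z) y w
    + Γ y u (Γ y w z) - Γ y w (Γ y u z) : E)

/-- `γ` is a geodesic on the (open) time set `s`: `D_t γ' = 0`. -/
def IsGeodesicOn (γ : ℝ → M) (s : Set ℝ) : Prop :=
  ContMDiffOn 𝓘(ℝ, ℝ) 𝓘(ℝ, E) 2 γ s ∧ ∀ t ∈ s, covDerivAlong (E := E) γ (velocity γ) t = 0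

/-- `J` is a Jacobi field along `γ` on the (open) time set `s`: `D_t D_t J + R(J, γ')γ' = 0`. -/
def IsJacobiFieldOn (γ : ℝ → M) (J : ∀ t, TangentSpace 𝓘(ℝ, E) (γ t)) (s : Set ℝ) : Prop :=
  ContMDiffOn 𝓘(ℝ, ℝ) 𝓘(ℝ, E).tangent 2
      (fun t ↦ (⟨γ t, J t⟩ : TangentBundle 𝓘(ℝ, E) M)) s ∧
    ∀ t ∈ s, covDerivAlong γ (covDerivAlong γ J) t
      + curvature (γ t) (J t) (velocity γ t) (velocity γ t) = 0

variable (E) in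
/-- The end points `γ a`, `γ b` are conjugate along the geodesic `γ`: some Jacobi field along `γ`
vanishes at `a` and at `b` but is not identically zero on `[a, b]`. -/
def AreConjugateAlong (γ : ℝ → M) (a b : ℝ) : Prop :=
  ∃ J : ∀ t, TangentSpace 𝓘(ℝ, E) (γ t), ∃ ε > 0, IsJacobiFieldOn γ J (Ioo (a - ε) (b + ε)) ∧
    J a = 0 ∧ J b = 0 ∧ ∃ t ∈ Icc a b, J t ≠ 0

/-- `γ` is a geodesic, defined on an open interval containing `[0, 1]`, that starts at time `0`
from `q` with velocity `v`. -/
def IsGeodesicFrom (q : M) (v : TangentSpace 𝓘(ℝ, E) q) (γ : ℝ → M) : Prop :=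
  (∃ ε > 0, IsGeodesicOn (E := E) γ (Ioo (0 - ε) (1 + ε))) ∧
    (⟨γ 0, velocity γ 0⟩ : TangentBundle 𝓘(ℝ, E) M) = ⟨q, v⟩

/-- The domain of the Riemannian exponential map `Exp_q`: the vectors `v` whose geodesic exists
up to time `1`. -/
def expDomain (q : M) : Set (TangentSpace 𝓘(ℝ, E) q) :=
  {v | ∃ γ : ℝ → M, IsGeodesicFrom q v γ}

open Classical in
/-- The Riemannian exponential map: `Exp_q v = γ 1` for the geodesic `γ` from `q` with velocity
`v` (with the irrelevant value `q` for `v` outside the domain). -/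
def expMap (q : M) (v : TangentSpace 𝓘(ℝ, E) q) : M :=
  if h : ∃ γ : ℝ → M, IsGeodesicFrom q v γ then h.choose 1 else q

/-- The Riemannian logarithm at `q`: the inverse of the restriction of `Exp_q` to a set
`D ⊆ T_q M` on which `Exp_q` is injective. -/
def logMap (q : M) (D : Set (TangentSpace 𝓘(ℝ, E) q)) : M → TangentSpace 𝓘(ℝ, E) q :=
  Function.invFunOn (expMap q) D

/-- The differential `d(Log_q)_p : T_p M → T_q M`, where the tangent spaces of the vector space
`T_q M` (whose underlying topological vector space is `E`) are identified with `T_q M`. -/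
def dLog (q : M) (D : Set (TangentSpace 𝓘(ℝ, E) q)) (p : M) :
    TangentSpace 𝓘(ℝ, E) p →L[ℝ] TangentSpace 𝓘(ℝ, E) q :=
  mfderiv 𝓘(ℝ, E) 𝓘(ℝ, E) (M' := E) (logMap q D) p

end Geometry

/-- Cubic Hermite polynomial with value `1`, slope `0` at `t₀` and value `0`, slope `0` at `t₁`. -/
def hermiteA0 (t₀ t₁ t : ℝ) : ℝ :=
  1 - 1 / (t₁ - t₀) ^ 2 * (t - t₀) ^ 2 + 2 / (t₁ - t₀) ^ 3 * ((t - t₀) ^ 2 * (t - t₁))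

/-- Cubic Hermite polynomial with value `0`, slope `1` at `t₀` and value `0`, slope `0` at `t₁`. -/
def hermiteB0 (t₀ t₁ t : ℝ) : ℝ :=
  (t - t₀) - 1 / (t₁ - t₀) * (t - t₀) ^ 2 + 1 / (t₁ - t₀) ^ 2 * ((t - t₀) ^ 2 * (t - t₁))

/-- Cubic Hermite polynomial with value `0`, slope `0` at `t₀` and value `0`, slope `1` at `t₁`. -/
def hermiteB1 (t₀ t₁ t : ℝ) : ℝ :=
  1 / (t₁ - t₀) ^ 2 * ((t - t₀) ^ 2 * (t - t₁))

section Interpolant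

variable {E : Type*} [NormedAddCommGroup E] [NormedSpace ℝ E] {M : Type*} [TopologicalSpace M]
  [ChartedSpace E M] [IsManifold 𝓘(ℝ, E) ∞ M]
  [RiemannianBundle (fun x : M ↦ TangentSpace 𝓘(ℝ, E) x)]

/-- The curve `a₀(t) Δ_p + b₀(t) v̂_p + b₁(t) v̂_q` in `T_q M`, with `Δ_p = Log_q p`,
`v̂_p = d(Log_q)_p v_p` and `v̂_q = v_q`; here `Log_q` is the inverse of `Exp_q` on `D`. -/
def tangentInterpolant (t₀ t₁ : ℝ) (p q : M) (D : Set (TangentSpace 𝓘(ℝ, E) q))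
    (v_p : TangentSpace 𝓘(ℝ, E) p) (v_q : TangentSpace 𝓘(ℝ, E) q) (t : ℝ) :
    TangentSpace 𝓘(ℝ, E) q :=
  hermiteA0 t₀ t₁ t • logMap q D p + hermiteB0 t₀ t₁ t • dLog q D p v_p + hermiteB1 t₀ t₁ t • v_q

/-- The interpolating curve `c(t) = Exp_q (a₀(t) Δ_p + b₀(t) v̂_p + b₁(t) v̂_q)`. -/
def hermiteCurve (t₀ t₁ : ℝ) (p q : M) (D : Set (TangentSpace 𝓘(ℝ, E) q))
    (v_p : TangentSpace 𝓘(ℝ, E) p) (v_q : TangentSpace 𝓘(ℝ, E) q) (t : ℝ) : M :=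
  expMap q (tangentInterpolant t₀ t₁ p q D v_p v_q t)

end Interpolant

end RiemannHermite

end

/-!
In a chart the geodesic equation is a smooth autonomous first order system for the pair
(position, velocity), so its solutions depend in a `C¹` way on the initial velocity. Hence the
domain of `Exp_q` is open, `Exp_q` is `C¹` on it, and the derivative of `v ↦ Exp_q (t v)` in a
direction `w` solves the linearized geodesic equation, which is the Jacobi equation: it is the
Jacobi field along `t ↦ Exp_q (t v)` that vanishes at `0` with covariant derivative `w` there.
If `p` and `q` are not conjugate, this field does not vanish at `t = 1` unless `w = 0`. So the
differential of `Exp_q` at `Log_q p` is invertible, and by the inverse function theorem `Log_q` is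
differentiable at `p`, with the inverse differential. Since the differential of `Exp_q` at `0` is
the identity, `Exp_q` turns Hermite data in the vector space `T_q M` into the required Hermite data
on the manifold, and there the cubic Hermite polynomials solve the problem.
-/

noncomputable section

-- Instance search on iterated spaces `E →L[ℝ] E →L[ℝ] ℝ` needs this depth.
set_option maxSynthPendingDepth 3

namespace RiemannHermite

section LocalFlow

open Metric

variable {V W : Type*} [NormedAddCommGroup V] [NormedSpace ℝ V] [NormedAddCommGroup W]
  [NormedSpace ℝ W]

/-- A two-sided Grönwall estimate for short times: where `‖R‖` is largest, the mean value
inequality bounds it by `δ (c + K ‖R‖)`. -/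
lemma norm_le_of_norm_deriv_le_add_mul_norm {R R' : ℝ → V} {δ K c : ℝ} (hδ : 0 < δ) (hK₀ : 0 ≤ K)
    (hK : δ * K ≤ 1 / 2) (hR₀ : R 0 = 0)
    (hR : ∀ t ∈ Icc (-δ) δ, HasDerivWithinAt R (R' t) (Icc (-δ) δ) t)
    (hbound : ∀ t ∈ Icc (-δ) δ, ‖R' t‖ ≤ c + K * ‖R t‖) :
    ∀ t ∈ Icc (-δ) δ, ‖R t‖ ≤ 2 * δ * c := by
  have hzero : (0 : ℝ) ∈ Icc (-δ) δ := ⟨by linarith, hδ.le⟩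
  obtain ⟨T, hT, hmax⟩ := isCompact_Icc.exists_isMaxOn ⟨0, hzero⟩
    (HasDerivWithinAt.continuousOn hR).norm
  have hmean : ‖R T - R 0‖ ≤ (c + K * ‖R T‖) * ‖T - 0‖ :=
    (convex_Icc (-δ) δ).norm_image_sub_le_of_norm_hasDerivWithin_le hR
      (fun t ht ↦ (hbound t ht).trans (by gcongr; exact hmax ht)) hzero hT
  have hRT : ‖R T‖ ≤ (c + K * ‖R T‖) * δ := by
    rw [hR₀, sub_zero, sub_zero, Real.norm_eq_abs] at hmean
    have : 0 ≤ c + K * ‖R T‖ := (norm_nonneg _).trans (hbound T hT)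
    exact hmean.trans (by gcongr; exact abs_le.2 hT)
  have hhalf : δ * K * ‖R T‖ ≤ 1 / 2 * ‖R T‖ := by gcongr
  intro t ht
  have : ‖R t‖ ≤ ‖R T‖ := hmax ht
  linarith

lemma norm_sub_sub_fderiv_le {F : V → W} {s : Set V} (hs : Convex ℝ s) {K : NNReal}
    (hF : ∀ z ∈ s, DifferentiableAt ℝ F z) (hlip : LipschitzOnWith K (fderiv ℝ F) s) {y y' : V}
    (hy : y ∈ s) (hy' : y' ∈ s) :
    ‖F y' - F y - fderiv ℝ F y (y' - y)‖ ≤ K * ‖y' - y‖ ^ 2 := by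
  have hconv : Convex ℝ (s ∩ closedBall y ‖y' - y‖) := hs.inter (convex_closedBall _ _)
  have hfderiv : ∀ x ∈ s ∩ closedBall y ‖y' - y‖,
      ‖fderiv ℝ F x - fderiv ℝ F y‖ ≤ K * ‖y' - y‖ := fun x hx ↦
    (hlip.norm_sub_le hx.1 hy).trans (by gcongr; simpa [dist_eq_norm] using hx.2)
  calc ‖F y' - F y - fderiv ℝ F y (y' - y)‖ ≤ K * ‖y' - y‖ * ‖y' - y‖ :=
        hconv.norm_image_sub_le_of_norm_hasFDerivWithin_le'
          (fun x hx ↦ (hF x hx.1).hasFDerivAt.hasFDerivWithinAt) hfderiv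
          ⟨hy, by simp⟩ ⟨hy', by simp [dist_eq_norm]⟩
    _ = K * ‖y' - y‖ ^ 2 := by ring

/-- The error in approximating the difference of two solutions `x`, `x'` of `y' = F y` by a solution
`A` of the equation linearized along `x` is quadratic. -/
lemma norm_sub_sub_linearized_le {F : V → V} {s : Set V} (hs : Convex ℝ s) {K₁ δ r : ℝ}
    {K₂ : NNReal} (hF : ∀ z ∈ s, DifferentiableAt ℝ F z)
    (hK₁ : ∀ z ∈ s, ‖fderiv ℝ F z‖ ≤ K₁) (hlip : LipschitzOnWith K₂ (fderiv ℝ F) s)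
    (hδ : 0 < δ) (hδK : δ * K₁ ≤ 1 / 2)
    {x x' : ℝ → V} {A : ℝ → V →L[ℝ] V} (hx : ∀ t ∈ Icc (-δ) δ, x t ∈ s)
    (hx' : ∀ t ∈ Icc (-δ) δ, x' t ∈ s)
    (hdx : ∀ t ∈ Icc (-δ) δ, HasDerivWithinAt x (F (x t)) (Icc (-δ) δ) t)
    (hdx' : ∀ t ∈ Icc (-δ) δ, HasDerivWithinAt x' (F (x' t)) (Icc (-δ) δ) t)
    (hdA : ∀ t ∈ Icc (-δ) δ, HasDerivWithinAt A (fderiv ℝ F (x t) ∘L A t) (Icc (-δ) δ) t)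
    (hA : A 0 = .id ℝ V) (hr : ∀ t ∈ Icc (-δ) δ, ‖x' t - x t‖ ≤ r) :
    ∀ t ∈ Icc (-δ) δ, ‖x' t - x t - A t (x' 0 - x 0)‖ ≤ 2 * δ * (K₂ * r ^ 2) := by
  have hzero : (0 : ℝ) ∈ Icc (-δ) δ := ⟨by linarith, hδ.le⟩
  refine norm_le_of_norm_deriv_le_add_mul_norm hδ
    ((norm_nonneg _).trans (hK₁ _ (hx 0 hzero))) hδK (by simp [hA])
    (fun t ht ↦ ((hdx' t ht).sub (hdx t ht)).sub
      ((hdA t ht).clm_apply (hasDerivWithinAt_const t _ (x' 0 - x 0)))) fun t ht ↦ ?_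
  have hsplit : F (x' t) - F (x t) - ((fderiv ℝ F (x t) ∘L A t) (x' 0 - x 0) + A t 0)
      = (F (x' t) - F (x t) - fderiv ℝ F (x t) (x' t - x t))
        + fderiv ℝ F (x t) (x' t - x t - A t (x' 0 - x 0)) := by
    simp only [ContinuousLinearMap.comp_apply, map_sub, map_zero]
    abel
  have htaylor := norm_sub_sub_fderiv_le hs hF hlip (hx t ht) (hx' t ht)
  calc _ ≤ ‖F (x' t) - F (x t) - fderiv ℝ F (x t) (x' t - x t)‖
        + ‖fderiv ℝ F (x t) (x' t - x t - A t (x' 0 - x 0))‖ := hsplit ▸ norm_add_le _ _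
    _ ≤ K₂ * r ^ 2 + K₁ * ‖x' t - x t - A t (x' 0 - x 0)‖ := by
        refine add_le_add (htaylor.trans (by gcongr; exact hr t ht)) ?_
        exact (ContinuousLinearMap.le_opNorm _ _).trans (by gcongr; exact hK₁ _ (hx t ht))

lemma hasFDerivAt_of_eventually_norm_sub_sub_le_sq {f : V → W} {f' : V →L[ℝ] W} {z : V} {C : ℝ}
    (h : ∀ᶠ z' in 𝓝 z, ‖f z' - f z - f' (z' - z)‖ ≤ C * ‖z' - z‖ ^ 2) : HasFDerivAt f f' z :=
  .of_isLittleO <| (Asymptotics.IsBigO.of_bound C <| h.mono fun _ hz' ↦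
    hz'.trans_eq (by rw [norm_pow, norm_norm])).trans_isLittleO
      (Asymptotics.isLittleO_pow_sub_sub z one_lt_two)

lemma exists_lipschitz_flow [CompleteSpace V] {G : V → V} {y₀ : V} (hG : ContDiffAt ℝ 1 G y₀)
    {U : Set V} (hU : U ∈ 𝓝 y₀) {δ₀ : ℝ} (hδ₀ : 0 < δ₀) :
    ∃ δ ∈ Ioc 0 δ₀, ∃ r > 0, ∃ L : NNReal, ∃ α : V → ℝ → V,
      (∀ y ∈ ball y₀ r, α y 0 = y ∧ ∀ t ∈ Icc (-δ) δ,
        α y t ∈ U ∧ HasDerivWithinAt (α y) (G (α y t)) (Icc (-δ) δ) t) ∧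
      ∀ t ∈ Icc (-δ) δ, LipschitzOnWith L (α · t) (ball y₀ r) := by
  obtain ⟨ε, hε, _, r, _, _, hr, hpl⟩ := IsPicardLindelof.of_contDiffAt_one hG
  obtain ⟨α, hα, L, hL⟩ := (hpl 0).exists_forall_mem_closedBall_eq_hasDerivWithinAt_lipschitzOnWith
  simp only [zero_sub, zero_add] at hα hL
  have hr' : (0 : ℝ) < r := hr
  obtain ⟨hα₀, hdα₀⟩ := hα y₀ (mem_closedBall_self hr'.le)
  obtain ⟨ρ, hρ, hρU⟩ := Metric.mem_nhds_iff.1 hU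
  have hcont : ContinuousAt (α y₀) 0 :=
    ((hdα₀ 0 ⟨by linarith, hε.le⟩).hasDerivAt (Icc_mem_nhds (by linarith) hε)).continuousAt
  obtain ⟨η, hη, hηρ⟩ := Metric.continuousAt_iff.1 hcont (ρ / 2) (by positivity)
  set δ : ℝ := min δ₀ (min ε (η / 2))
  have hδε : δ ≤ ε := (min_le_right _ _).trans (min_le_left _ _)
  have hδη : δ < η :=
    ((min_le_right _ _).trans (min_le_right _ _)).trans_lt (half_lt_self hη)
  have hsub : Icc (-δ) δ ⊆ Icc (-ε) ε := Icc_subset_Icc (neg_le_neg hδε) hδε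
  have hball : ball y₀ (min r (ρ / (2 * (L + 1)))) ⊆ closedBall y₀ r :=
    (ball_subset_ball (min_le_left _ _)).trans ball_subset_closedBall
  refine ⟨δ, ⟨by positivity, min_le_left _ _⟩, min r (ρ / (2 * (L + 1))), by positivity, L, α,
    fun y hy ↦ ⟨(hα y (hball hy)).1, fun t ht ↦
      ⟨hρU ?_, ((hα y (hball hy)).2 t (hsub ht)).mono hsub⟩⟩,
    fun t ht ↦ (hL t (hsub ht)).mono hball⟩
  have hnear : dist (α y t) (α y₀ t) ≤ ρ / 2 := calc
    _ ≤ L * dist y y₀ := (hL t (hsub ht)).dist_le_mul _ (hball hy) _ (mem_closedBall_self hr'.le)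
    _ ≤ (L + 1) * (ρ / (2 * (L + 1))) := by
      gcongr
      · linarith
      · exact (mem_ball.1 hy).le.trans (min_le_right _ _)
    _ = ρ / 2 := by field_simp
  have hshort : dist (α y₀ t) y₀ < ρ / 2 := by
    rw [hα₀] at hηρ
    exact hηρ (by simpa using (abs_le.2 ht).trans_lt hδη)
  exact mem_ball.2 (by linarith [dist_triangle (α y t) (α y₀ t) y₀])

/-- `Φ` is a local flow of the vector field `F` for initial points in the open set `S` and times in
`(-δ, δ)`. Its trajectories stay in `U`, and `A z t`, the derivative of `Φ · t` at `z`, solves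
the equation linearized along `Φ z`. -/
structure IsLocalFlow (F : V → V) (U : Set V) (δ : ℝ) (S : Set V) (Φ : V → ℝ → V)
    (A : V → ℝ → V →L[ℝ] V) : Prop where
  pos : 0 < δ
  isOpen : IsOpen S
  zero : ∀ z ∈ S, Φ z 0 = z
  mem : ∀ z ∈ S, ∀ t ∈ Ioo (-δ) δ, Φ z t ∈ U
  hasDerivAt : ∀ z ∈ S, ∀ t ∈ Ioo (-δ) δ, HasDerivAt (Φ z) (F (Φ z t)) t
  hasDerivAt_deriv : ∀ z ∈ S, ∀ t ∈ Ioo (-δ) δ, HasDerivAt (A z) (fderiv ℝ F (Φ z t) ∘L A z t) t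
  hasFDerivAt : ∀ z ∈ S, ∀ t ∈ Ioo (-δ) δ, HasFDerivAt (fun z ↦ Φ z t) (A z t) z
  continuousAt_deriv : ∀ z ∈ S, ∀ t ∈ Ioo (-δ) δ, ContinuousAt (fun z ↦ A z t) z

lemma IsLocalFlow.contDiffAt {F : V → V} {U S : Set V} {δ : ℝ} {Φ : V → ℝ → V}
    {A : V → ℝ → V →L[ℝ] V} (h : IsLocalFlow F U δ S Φ A) {z : V} (hz : z ∈ S) {t : ℝ}
    (ht : t ∈ Ioo (-δ) δ) : ContDiffAt ℝ 1 (fun z ↦ Φ z t) z :=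
  contDiffAt_one_iff.2 ⟨fun z ↦ A z t, S, h.isOpen.mem_nhds hz,
    fun z' hz' ↦ (h.continuousAt_deriv z' hz' t ht).continuousWithinAt,
    fun z' hz' ↦ h.hasFDerivAt z' hz' t ht⟩

/-- The vector field `F` together with its linearization: its integral curves are pairs `(x, A)`
with `x' = F x` and `A' = dF_x ∘ A`. -/
def variationalField (F : V → V) (y : V × (V →L[ℝ] V)) : V × (V →L[ℝ] V) :=
  (F y.1, fderiv ℝ F y.1 ∘L y.2)

lemma contDiffAt_variationalField {F : V → V} {y : V × (V →L[ℝ] V)} (hF : ContDiffAt ℝ 2 F y.1) :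
    ContDiffAt ℝ 1 (variationalField F) y :=
  have hdF : ContDiffAt ℝ 1 (fderiv ℝ F) y.1 := hF.fderiv_right (by norm_num)
  ((hF.of_le (by norm_num)).comp y contDiffAt_fst).prodMk
    ((hdF.comp y contDiffAt_fst).clm_comp contDiffAt_snd)

lemma exists_ball_fderiv_bounds {F : V → W} {z₀ : V} (hF : ContDiffAt ℝ 2 F z₀) :
    ∃ ρ > 0, ∃ K₁ > 0, ∃ K₂ : NNReal, (∀ z ∈ ball z₀ ρ, DifferentiableAt ℝ F z) ∧
      (∀ z ∈ ball z₀ ρ, ‖fderiv ℝ F z‖ ≤ K₁) ∧ LipschitzOnWith K₂ (fderiv ℝ F) (ball z₀ ρ) := by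
  have hdF : ContDiffAt ℝ 1 (fderiv ℝ F) z₀ := hF.fderiv_right (by norm_num)
  obtain ⟨K₂, s, hs, hlip⟩ := hdF.exists_lipschitzOnWith
  have hev : ∀ᶠ z in 𝓝 z₀,
      z ∈ s ∧ DifferentiableAt ℝ F z ∧ ‖fderiv ℝ F z‖ < ‖fderiv ℝ F z₀‖ + 1 :=
    Filter.Eventually.and hs <|
      ((hF.eventually (by simp)).mono fun _ hz ↦ hz.differentiableAt two_ne_zero).and
        (hdF.continuousAt.norm.eventually_lt_const (by simp))
  obtain ⟨ρ, hρ, hball⟩ := Metric.eventually_nhds_iff_ball.1 hev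
  exact ⟨ρ, hρ, _, by positivity, K₂, fun z hz ↦ (hball z hz).2.1,
    fun z hz ↦ (hball z hz).2.2.le, hlip.mono fun z hz ↦ (hball z hz).1⟩

lemma exists_isLocalFlow [CompleteSpace V] {F : V → V} {z₀ : V} (hF : ContDiffAt ℝ 2 F z₀)
    {U : Set V} (hU : U ∈ 𝓝 z₀) : ∃ δ S Φ A, IsLocalFlow F U δ S Φ A ∧ z₀ ∈ S := by
  obtain ⟨ρ, hρ, K₁, hK₁, K₂, hdiff, hbound, hlip⟩ := exists_ball_fderiv_bounds hF
  let Y (z : V) : V × (V →L[ℝ] V) := (z, .id ℝ V)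
  have hY : ∀ z z', ‖Y z' - Y z‖ = ‖z' - z‖ := fun z z' ↦ by simp [Y, Prod.norm_def]
  have hnhds : Prod.fst ⁻¹' (ball z₀ ρ ∩ U) ∈ 𝓝 (Y z₀) :=
    continuousAt_fst.preimage_mem_nhds (inter_mem (ball_mem_nhds _ hρ) hU)
  obtain ⟨δ, ⟨hδ, hδK⟩, r, hr, L, α, hα, hL⟩ := exists_lipschitz_flow
    (contDiffAt_variationalField (y := Y z₀) hF) hnhds (δ₀ := 1 / (2 * K₁)) (by positivity)
  replace hδK : δ * K₁ ≤ 1 / 2 := calc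
    δ * K₁ ≤ 1 / (2 * K₁) * K₁ := by gcongr
    _ = 1 / 2 := by field_simp
  set S : Set V := Y ⁻¹' ball (Y z₀) r
  have hS : IsOpen S := isOpen_ball.preimage (by fun_prop)
  have hmem (t) (ht : t ∈ Ioo (-δ) δ) : t ∈ Icc (-δ) δ := Ioo_subset_Icc_self ht
  have hder (z) (hz : z ∈ S) (t) (ht : t ∈ Ioo (-δ) δ) :=
    ((hα (Y z) hz).2 t (hmem t ht)).2.hasDerivAt (Icc_mem_nhds ht.1 ht.2)
  have hquad (z) (hz : z ∈ S) (z') (hz' : z' ∈ S) (t) (ht : t ∈ Icc (-δ) δ) :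
      ‖(α (Y z') t).1 - (α (Y z) t).1 - (α (Y z) t).2 (z' - z)‖
        ≤ 2 * δ * (K₂ * (L * ‖z' - z‖) ^ 2) := by
    have hest := norm_sub_sub_linearized_le (convex_ball z₀ ρ) hdiff hbound hlip hδ hδK
      (fun t ht ↦ ((hα _ hz).2 t ht).1.1) (fun t ht ↦ ((hα _ hz').2 t ht).1.1)
      (fun t ht ↦ ((hα _ hz).2 t ht).2.fst) (fun t ht ↦ ((hα _ hz').2 t ht).2.fst)
      (fun t ht ↦ ((hα _ hz).2 t ht).2.snd) (congrArg Prod.snd (hα _ hz).1)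
      (fun t ht ↦ (norm_fst_le _).trans ((hL t ht).norm_sub_le hz' hz)) t ht
    rwa [(hα _ hz).1, (hα _ hz').1, hY] at hest
  refine ⟨δ, S, fun z t ↦ (α (Y z) t).1, fun z t ↦ (α (Y z) t).2,
    ⟨hδ, hS, fun z hz ↦ congrArg Prod.fst (hα _ hz).1,
      fun z hz t ht ↦ ((hα _ hz).2 t (hmem t ht)).1.2, fun z hz t ht ↦ (hder z hz t ht).fst,
      fun z hz t ht ↦ (hder z hz t ht).snd, fun z hz t ht ↦ ?_, fun z hz t ht ↦ ?_⟩,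
    mem_ball_self hr⟩
  · refine hasFDerivAt_of_eventually_norm_sub_sub_le_sq (C := 2 * δ * (K₂ * L ^ 2)) ?_
    filter_upwards [hS.mem_nhds hz] with z' hz'
    exact (hquad z hz z' hz' t (hmem t ht)).trans_eq (by ring)
  · have hcont : ContinuousOn (fun z' ↦ α (Y z') t) S :=
      (hL t (hmem t ht)).continuousOn.comp (by fun_prop) (mapsTo_preimage _ _)
    exact (hcont.continuousAt (hS.mem_nhds hz)).snd

end LocalFlow

section CoordinateChristoffel

variable {E F : Type*} [NormedAddCommGroup E] [NormedSpace ℝ E] [NormedAddCommGroup F]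
  [NormedSpace ℝ F]

/-- The trilinear form `(u, w, z) ↦ (D u w z + D w u z - D z u w) / 2` of the Koszul formula, for
`D` the derivative of a field of bilinear forms. -/
def koszulForm (D : E →L[ℝ] E →L[ℝ] E →L[ℝ] ℝ) : E →L[ℝ] E →L[ℝ] E →L[ℝ] ℝ :=
  (1 / 2 : ℝ) • (D + D.flip -
    ((ContinuousLinearMap.flipₗᵢ ℝ E E ℝ).toContinuousLinearEquiv :
      (E →L[ℝ] E →L[ℝ] ℝ) →L[ℝ] (E →L[ℝ] E →L[ℝ] ℝ)).comp D.flip)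

lemma koszulForm_apply_apply (D : E →L[ℝ] E →L[ℝ] E →L[ℝ] ℝ) (u w z : E) :
    koszulForm D u w z = 1 / 2 * (D u w z + D w u z - D z u w) := rfl

/-- The Christoffel symbol of a field `g` of bilinear forms, as a continuous bilinear map. It is
meaningful only where `g y` is invertible: elsewhere `ContinuousLinearMap.inverse` is zero. -/
def christoffelForm (g : E → E →L[ℝ] E →L[ℝ] ℝ) (y : E) : E →L[ℝ] E →L[ℝ] E :=
  (ContinuousLinearMap.compL ℝ E (E →L[ℝ] ℝ) E (g y).inverse).comp (koszulForm (fderiv ℝ g y))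

lemma christoffelForm_apply (g : E → E →L[ℝ] E →L[ℝ] ℝ) (y u w : E) :
    christoffelForm g y u w = (g y).inverse (koszulForm (fderiv ℝ g y) u w) := rfl

lemma apply_christoffelForm {g : E → E →L[ℝ] E →L[ℝ] ℝ} {y : E} (h : (g y).IsInvertible)
    (u w z : E) : g y (christoffelForm g y u w) z =
      1 / 2 * (fderiv ℝ g y u w z + fderiv ℝ g y w u z - fderiv ℝ g y z u w) := by
  rw [christoffelForm_apply, h.self_apply_inverse, koszulForm_apply_apply]

lemma contDiff_koszulForm {n : ℕ∞ω} : ContDiff ℝ n (koszulForm (E := E)) := by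
  have hflip : ContDiff ℝ n fun D : E →L[ℝ] E →L[ℝ] E →L[ℝ] ℝ ↦ D.flip :=
    (ContinuousLinearMap.flipₗᵢ ℝ E E (E →L[ℝ] ℝ)).contDiff
  exact ((contDiff_id.add hflip).sub (contDiff_const.clm_comp hflip)).const_smul (1 / 2 : ℝ)

lemma contDiffAt_christoffelForm [CompleteSpace E] {g : E → E →L[ℝ] E →L[ℝ] ℝ} {y : E}
    (hg : ContDiffAt ℝ ∞ g y) (h : (g y).IsInvertible) : ContDiffAt ℝ ∞ (christoffelForm g) y := by
  have hinverse : ContDiffAt ℝ ∞ (fun y ↦ (g y).inverse) y :=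
    h.contDiffAt_map_inverse.comp y hg
  have hkoszul : ContDiffAt ℝ ∞ (fun y ↦ koszulForm (fderiv ℝ g y)) y :=
    contDiff_koszulForm.contDiffAt.comp y (hg.fderiv_right (by simp))
  exact ((ContinuousLinearMap.compL ℝ E (E →L[ℝ] ℝ) E).contDiff.contDiffAt.comp y
    hinverse).clm_comp hkoszul

lemma hasFDerivAt_apply_apply {G H : Type*} [NormedAddCommGroup G] [NormedSpace ℝ G]
    [NormedAddCommGroup H] [NormedSpace ℝ H] {g : E → F →L[ℝ] G →L[ℝ] H} {y : E}
    (hg : DifferentiableAt ℝ g y) (u : F) (w : G) :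
    HasFDerivAt (fun y' ↦ g y' u w) (((fderiv ℝ g y).flip u).flip w) y :=
  ((hg.hasFDerivAt.clm_apply (hasFDerivAt_const u y)).clm_apply
    (hasFDerivAt_const w y)).congr_fderiv (by ext; simp)

lemma fderiv_symm_of_eventually {H : Type*} [NormedAddCommGroup H] [NormedSpace ℝ H]
    {g : E → F →L[ℝ] F →L[ℝ] H} {y : E}
    (hg : DifferentiableAt ℝ g y) (hs : ∀ᶠ y' in 𝓝 y, ∀ u w, g y' u w = g y' w u) (z : E)
    (u w : F) : fderiv ℝ g y z u w = fderiv ℝ g y z w u :=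
  DFunLike.congr_fun ((hasFDerivAt_apply_apply hg u w).unique <|
    (hasFDerivAt_apply_apply hg w u).congr_of_eventuallyEq (hs.mono fun _ h ↦ h u w)) z

lemma christoffelForm_symm {g : E → E →L[ℝ] E →L[ℝ] ℝ} {y : E}
    (hg : DifferentiableAt ℝ g y) (hs : ∀ᶠ y' in 𝓝 y, ∀ u w, g y' u w = g y' w u) (u w : E) :
    christoffelForm g y u w = christoffelForm g y w u := by
  rw [christoffelForm_apply, christoffelForm_apply]
  congr 1
  ext z
  rw [koszulForm_apply_apply, koszulForm_apply_apply, fderiv_symm_of_eventually hg hs z u w]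
  ring

lemma fderiv_pullback_form {g₀ : E → E →L[ℝ] E →L[ℝ] ℝ} {g₁ : F → F →L[ℝ] F →L[ℝ] ℝ} {ψ : E → F}
    {y : E} (hψ : ContDiffAt ℝ 2 ψ y) (hg₀ : DifferentiableAt ℝ g₀ y)
    (hg₁ : DifferentiableAt ℝ g₁ (ψ y))
    (hpull : ∀ᶠ y' in 𝓝 y, ∀ u w, g₀ y' u w = g₁ (ψ y') (fderiv ℝ ψ y' u) (fderiv ℝ ψ y' w))
    (z u w : E) :
    fderiv ℝ g₀ y z u w =
      fderiv ℝ g₁ (ψ y) (fderiv ℝ ψ y z) (fderiv ℝ ψ y u) (fderiv ℝ ψ y w)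
      + g₁ (ψ y) (fderiv ℝ (fderiv ℝ ψ) y z u) (fderiv ℝ ψ y w)
      + g₁ (ψ y) (fderiv ℝ ψ y u) (fderiv ℝ (fderiv ℝ ψ) y z w) := by
  have hdψ : HasFDerivAt (fderiv ℝ ψ) (fderiv ℝ (fderiv ℝ ψ) y) y :=
    ((hψ.fderiv_right (m := 1) (by norm_num)).differentiableAt one_ne_zero).hasFDerivAt
  have hg₁ψ := hg₁.hasFDerivAt.comp y (hψ.differentiableAt two_ne_zero).hasFDerivAt
  have hpull' := ((hg₁ψ.clm_apply (hdψ.clm_apply (hasFDerivAt_const u y))).clm_apply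
    (hdψ.clm_apply (hasFDerivAt_const w y))).congr_of_eventuallyEq (hpull.mono fun _ h ↦ h u w)
  have := DFunLike.congr_fun ((hasFDerivAt_apply_apply hg₀ u w).unique hpull') z
  simp only [ContinuousLinearMap.flip_apply, Function.comp_apply, ContinuousLinearMap.comp_zero,
    zero_add, ContinuousLinearMap.flip_add, add_apply, ContinuousLinearMap.comp_apply] at this
  rw [this]
  ring

/-- The transformation law of Christoffel symbols under a change of coordinates `ψ`. -/
lemma fderiv_christoffelForm_eq_add {g₀ : E → E →L[ℝ] E →L[ℝ] ℝ} {g₁ : F → F →L[ℝ] F →L[ℝ] ℝ}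
    {ψ : E → F} {y : E} (hψ : ContDiffAt ℝ 2 ψ y) (hsurj : Function.Surjective (fderiv ℝ ψ y))
    (hg₀ : DifferentiableAt ℝ g₀ y) (hg₁ : DifferentiableAt ℝ g₁ (ψ y))
    (hi₀ : (g₀ y).IsInvertible) (hi₁ : (g₁ (ψ y)).IsInvertible)
    (hs : ∀ u w, g₁ (ψ y) u w = g₁ (ψ y) w u)
    (hpull : ∀ᶠ y' in 𝓝 y, ∀ u w, g₀ y' u w = g₁ (ψ y') (fderiv ℝ ψ y' u) (fderiv ℝ ψ y' w))
    (u w : E) :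
    fderiv ℝ ψ y (christoffelForm g₀ y u w) =
      christoffelForm g₁ (ψ y) (fderiv ℝ ψ y u) (fderiv ℝ ψ y w)
        + fderiv ℝ (fderiv ℝ ψ) y u w := by
  have hsymm : ∀ a b, fderiv ℝ (fderiv ℝ ψ) y a b = fderiv ℝ (fderiv ℝ ψ) y b a :=
    (hψ.isSymmSndFDerivAt (by simp)).eq
  apply hi₁.injective
  ext z'
  obtain ⟨z, rfl⟩ := hsurj z'
  rw [← hpull.self_of_nhds, apply_christoffelForm hi₀, map_add, add_apply,
    apply_christoffelForm hi₁, fderiv_pullback_form hψ hg₀ hg₁ hpull,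
    fderiv_pullback_form hψ hg₀ hg₁ hpull, fderiv_pullback_form hψ hg₀ hg₁ hpull,
    hsymm w u, hsymm z u, hsymm z w, hs (fderiv ℝ ψ y w) (fderiv ℝ (fderiv ℝ ψ) y u z)]
  ring

end CoordinateChristoffel

section Charts

variable {E : Type*} [NormedAddCommGroup E] {M : Type*} [TopologicalSpace M] [ChartedSpace E M]

/-- The change of coordinates from the chart at `x₀` to the chart at `x₁`. -/
def transition (x₀ x₁ : M) : E → E := chartAt E x₁ ∘ (chartAt E x₀).symm

lemma transition_chart {x₀ x₁ m : M} (h₀ : m ∈ (chartAt E x₀).source) :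
    transition x₀ x₁ (chartAt E x₀ m) = chartAt E x₁ m := by
  rw [transition, Function.comp_apply, (chartAt E x₀).left_inv h₀]

variable [NormedSpace ℝ E]

/-- The differential `T_m M → E` of the chart at `x₀`, with `T_m M` seen as the model space `E`. -/
def chartDeriv (x₀ m : M) : E →L[ℝ] E :=
  mfderiv 𝓘(ℝ, E) 𝓘(ℝ, E) (chartAt E x₀) m

/-- The differential at `y` of the inverse of the chart at `x₀`, with its target tangent space seen
as the model space `E`. -/
def chartSymmDeriv (x₀ : M) (y : E) : E →L[ℝ] E :=
  mfderiv 𝓘(ℝ, E) 𝓘(ℝ, E) (chartAt E x₀).symm y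

variable [IsManifold 𝓘(ℝ, E) ∞ M]

lemma mdifferentiable_chartAt (x₀ : M) : (chartAt E x₀).MDifferentiable 𝓘(ℝ, E) 𝓘(ℝ, E) :=
  have : IsManifold 𝓘(ℝ, E) 1 M := .of_le (n := ∞) (by simp)
  mdifferentiable_chart x₀

lemma contMDiffAt_chart {x₀ m : M} (hm : m ∈ (chartAt E x₀).source) :
    ContMDiffAt 𝓘(ℝ, E) 𝓘(ℝ, E) ∞ (chartAt E x₀) m :=
  contMDiffOn_chart.contMDiffAt ((chartAt E x₀).open_source.mem_nhds hm)

lemma contMDiffAt_chart_symm {x₀ : M} {y : E} (hy : y ∈ (chartAt E x₀).target) :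
    ContMDiffAt 𝓘(ℝ, E) 𝓘(ℝ, E) ∞ (chartAt E x₀).symm y :=
  contMDiffOn_chart_symm.contMDiffAt ((chartAt E x₀).open_target.mem_nhds hy)

lemma contDiffAt_transition {x₀ x₁ m : M} (h₀ : m ∈ (chartAt E x₀).source)
    (h₁ : m ∈ (chartAt E x₁).source) :
    ContDiffAt ℝ ∞ (transition x₀ x₁ : E → E) (chartAt E x₀ m) := by
  rw [← contMDiffAt_iff_contDiffAt]
  refine ContMDiffAt.comp _ ?_ (contMDiffAt_chart_symm ((chartAt E x₀).map_source h₀))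
  rw [(chartAt E x₀).left_inv h₀]
  exact contMDiffAt_chart h₁

lemma chartDeriv_self (x : M) : chartDeriv x x = ContinuousLinearMap.id ℝ E := by
  have : IsManifold 𝓘(ℝ, E) 1 M := .of_le (n := ∞) (by simp)
  ext v
  rw [chartDeriv, mfderiv_chartAt_eq_tangentCoordChange (mem_chart_source E x)]
  exact tangentCoordChange_self (mem_extChartAt_source x)

lemma chartSymmDeriv_comp_chartDeriv {x₀ m : M} (hm : m ∈ (chartAt E x₀).source) :
    (chartSymmDeriv x₀ (chartAt E x₀ m)).comp (chartDeriv x₀ m) = ContinuousLinearMap.id ℝ E :=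
  (mdifferentiable_chartAt x₀).symm_comp_deriv hm

lemma chartDeriv_comp_chartSymmDeriv {x₀ m : M} (hm : m ∈ (chartAt E x₀).source) :
    (chartDeriv x₀ m).comp (chartSymmDeriv x₀ (chartAt E x₀ m)) = ContinuousLinearMap.id ℝ E := by
  have h := (mdifferentiable_chartAt x₀).comp_symm_deriv ((chartAt E x₀).map_source hm)
  rwa [(chartAt E x₀).left_inv hm] at h

lemma fderiv_transition {x₀ x₁ m : M} (h₀ : m ∈ (chartAt E x₀).source)
    (h₁ : m ∈ (chartAt E x₁).source) :
    fderiv ℝ (transition x₀ x₁ : E → E) (chartAt E x₀ m) =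
      (chartDeriv x₁ m).comp (chartSymmDeriv x₀ (chartAt E x₀ m)) := by
  have h := mfderiv_comp_of_eq (I := 𝓘(ℝ, E)) (I' := 𝓘(ℝ, E)) (I'' := 𝓘(ℝ, E))
    ((mdifferentiable_chartAt x₁).mdifferentiableAt h₁)
    ((mdifferentiable_chartAt x₀).mdifferentiableAt_symm ((chartAt E x₀).map_source h₀))
    ((chartAt E x₀).left_inv h₀)
  rw [(chartAt E x₀).left_inv h₀] at h
  exact mfderiv_eq_fderiv.symm.trans h

lemma fderiv_transition_comp_chartDeriv {x₀ x₁ m : M} (h₀ : m ∈ (chartAt E x₀).source)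
    (h₁ : m ∈ (chartAt E x₁).source) :
    (fderiv ℝ (transition x₀ x₁ : E → E) (chartAt E x₀ m)).comp (chartDeriv x₀ m)
      = chartDeriv x₁ m := by
  rw [fderiv_transition h₀ h₁, ContinuousLinearMap.comp_assoc, chartSymmDeriv_comp_chartDeriv h₀,
    ContinuousLinearMap.comp_id]

lemma isInvertible_chartDeriv {x₀ m : M} (hm : m ∈ (chartAt E x₀).source) :
    (chartDeriv x₀ m : E →L[ℝ] E).IsInvertible :=
  .of_inverse (chartDeriv_comp_chartSymmDeriv hm) (chartSymmDeriv_comp_chartDeriv hm)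

lemma isInvertible_chartSymmDeriv {x₀ m : M} (hm : m ∈ (chartAt E x₀).source) :
    (chartSymmDeriv x₀ (chartAt E x₀ m) : E →L[ℝ] E).IsInvertible :=
  .of_inverse (chartSymmDeriv_comp_chartDeriv hm) (chartDeriv_comp_chartSymmDeriv hm)

lemma contMDiffOn_coordinateVectorField (x₀ : M) (u : E) :
    ContMDiffOn 𝓘(ℝ, E) 𝓘(ℝ, E).tangent ∞
      (fun y ↦ (⟨(chartAt E x₀).symm y, mfderiv 𝓘(ℝ, E) 𝓘(ℝ, E) (chartAt E x₀).symm y u⟩ :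
        TangentBundle 𝓘(ℝ, E) M)) (chartAt E x₀).target := by
  have htangentMap : ContMDiffOn 𝓘(ℝ, E).tangent 𝓘(ℝ, E).tangent ∞
      (tangentMapWithin 𝓘(ℝ, E) 𝓘(ℝ, E) (chartAt E x₀).symm (chartAt E x₀).target) _ :=
    contMDiffOn_chart_symm (n := ∞).contMDiffOn_tangentMapWithin
      (m := ∞) (by simp) (chartAt E x₀).open_target.uniqueMDiffOn
  have hconst : ContMDiff 𝓘(ℝ, E) 𝓘(ℝ, E).tangent ∞
      (fun y ↦ (⟨y, u⟩ : TangentBundle 𝓘(ℝ, E) E)) := fun y ↦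
    Bundle.contMDiffAt_totalSpace.2 ⟨contMDiffAt_id, by simpa using contMDiffAt_const⟩
  refine (htangentMap.comp hconst.contMDiffOn fun y hy ↦ hy).congr fun y hy ↦ ?_
  rw [Function.comp_apply, tangentMapWithin,
    mfderivWithin_of_mem_nhds ((chartAt E x₀).open_target.mem_nhds hy)]

end Charts

section Metric

variable {E : Type*} [NormedAddCommGroup E] [NormedSpace ℝ E] {M : Type*} [TopologicalSpace M]
  [ChartedSpace E M] [RiemannianBundle (fun x : M ↦ TangentSpace 𝓘(ℝ, E) x)]

/-- The inner product of `T_m M`, seen on the model space `E`. -/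
def innerAt (m : M) (u w : E) : ℝ :=
  innerSL ℝ (E := TangentSpace 𝓘(ℝ, E) m) u w

lemma innerAt_comm (m : M) (u w : E) : innerAt m u w = innerAt m w u :=
  real_inner_comm (F := TangentSpace 𝓘(ℝ, E) m) w u

lemma innerAt_self_eq_zero {m : M} {u : E} : innerAt m u u = 0 ↔ u = 0 :=
  inner_self_eq_zero (𝕜 := ℝ) (E := TangentSpace 𝓘(ℝ, E) m)

lemma metricInChart_apply (x₀ : M) (y u w : E) :
    metricInChart x₀ y u w =
      innerAt ((chartAt E x₀).symm y) (chartSymmDeriv x₀ y u) (chartSymmDeriv x₀ y w) := rfl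

lemma metricInChart_comm (x₀ : M) (y u w : E) :
    metricInChart x₀ y u w = metricInChart x₀ y w u := innerAt_comm _ _ _

lemma metricInChart_chart_apply {x₀ m : M} (hm : m ∈ (chartAt E x₀).source) (u w : E) :
    metricInChart x₀ (chartAt E x₀ m) u w =
      innerAt m (chartSymmDeriv x₀ (chartAt E x₀ m) u) (chartSymmDeriv x₀ (chartAt E x₀ m) w) := by
  rw [metricInChart_apply, (chartAt E x₀).left_inv hm]

variable [IsManifold 𝓘(ℝ, E) ∞ M]

lemma metricInChart_self_eq_zero {x₀ : M} {y : E} (hy : y ∈ (chartAt E x₀).target) {u : E} :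
    metricInChart x₀ y u u = 0 ↔ u = 0 := by
  have hinj := (isInvertible_chartSymmDeriv ((chartAt E x₀).map_target hy)).injective
  rw [(chartAt E x₀).right_inv hy] at hinj
  rw [metricInChart_apply, innerAt_self_eq_zero, map_eq_zero_iff _ hinj]

lemma isInvertible_metricInChart [FiniteDimensional ℝ E] {x₀ : M} {y : E}
    (hy : y ∈ (chartAt E x₀).target) : (metricInChart x₀ y).IsInvertible := by
  have hinj : Function.Injective (metricInChart x₀ y) :=
    (injective_iff_map_eq_zero _).2 fun u hu ↦
      (metricInChart_self_eq_zero hy).1 (DFunLike.congr_fun hu u)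
  have hdim : Module.finrank ℝ E = Module.finrank ℝ (E →L[ℝ] ℝ) :=
    (Subspace.dual_finrank_eq (K := ℝ) (V := E)).symm.trans
      (LinearMap.toContinuousLinearMap (𝕜 := ℝ) (E := E) (F' := ℝ)).finrank_eq
  exact ⟨(LinearEquiv.ofInjectiveOfFinrankEq _ hinj hdim).toContinuousLinearEquiv, by ext; rfl⟩

lemma metricInChart_transition {x₀ x₁ m : M} (h₀ : m ∈ (chartAt E x₀).source)
    (h₁ : m ∈ (chartAt E x₁).source) (u w : E) :
    metricInChart x₀ (chartAt E x₀ m) u w =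
      metricInChart x₁ (transition x₀ x₁ (chartAt E x₀ m))
        (fderiv ℝ (transition x₀ x₁) (chartAt E x₀ m) u)
        (fderiv ℝ (transition x₀ x₁) (chartAt E x₀ m) w) := by
  have hsymmDeriv : ∀ u, chartSymmDeriv x₁ (chartAt E x₁ m)
      (((chartDeriv x₁ m).comp (chartSymmDeriv x₀ (chartAt E x₀ m))) u)
      = chartSymmDeriv x₀ (chartAt E x₀ m) u := fun u ↦
    DFunLike.congr_fun (chartSymmDeriv_comp_chartDeriv h₁) _
  rw [transition_chart h₀, fderiv_transition h₀ h₁, metricInChart_chart_apply h₀,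
    metricInChart_chart_apply h₁, hsymmDeriv, hsymmDeriv]

lemma contDiffOn_metricInChart [FiniteDimensional ℝ E]
    [IsContMDiffRiemannianBundle 𝓘(ℝ, E) ∞ E (fun x : M ↦ TangentSpace 𝓘(ℝ, E) x)] (x₀ : M) :
    ContDiffOn ℝ ∞ (metricInChart (E := E) x₀) (chartAt E x₀).target := by
  have : IsManifold 𝓘(ℝ, E) 1 M := .of_le (n := ∞) (by simp)
  refine contDiffOn_clm_apply.2 fun u ↦ contDiffOn_clm_apply.2 fun w ↦ ?_
  rw [← contMDiffOn_iff_contDiffOn]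
  exact ContMDiffOn.inner_bundle (F := E) (E := fun x : M ↦ TangentSpace 𝓘(ℝ, E) x)
    (b := fun y ↦ (chartAt E x₀).symm y)
    (v := fun y ↦ mfderiv 𝓘(ℝ, E) 𝓘(ℝ, E) (chartAt E x₀).symm y u)
    (w := fun y ↦ mfderiv 𝓘(ℝ, E) 𝓘(ℝ, E) (chartAt E x₀).symm y w)
    (contMDiffOn_coordinateVectorField x₀ u) (contMDiffOn_coordinateVectorField x₀ w)

end Metric

section CurvesInNormedSpaces

lemma contDiffAt_zero_of_hasDerivAt {F : Type*} [NormedAddCommGroup F] [NormedSpace ℝ F]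
    {Y Y' : ℝ → F} {t : ℝ} (hY : ∀ᶠ τ in 𝓝 t, HasDerivAt Y (Y' τ) τ) : ContDiffAt ℝ 0 Y t :=
  contDiffAt_zero.2 ⟨_, hY, fun _ hτ ↦ hτ.continuousAt.continuousWithinAt⟩

lemma contDiffAt_succ_of_hasDerivAt {F : Type*} [NormedAddCommGroup F] [NormedSpace ℝ F]
    {Y Y' : ℝ → F} {t : ℝ} {n : ℕ} (hY : ∀ᶠ τ in 𝓝 t, HasDerivAt Y (Y' τ) τ)
    (hY' : ContDiffAt ℝ n Y' t) : ContDiffAt ℝ (n + 1) Y t :=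
  contDiffAt_succ_iff_hasFDerivAt.2 ⟨fun τ ↦ (1 : ℝ →L[ℝ] ℝ).smulRight (Y' τ),
    ⟨_, hY, fun _ hτ ↦ hτ⟩, contDiffAt_const.smulRight hY'⟩

lemma hasDerivAt_fderiv_apply {E F : Type*} [NormedAddCommGroup E] [NormedSpace ℝ E]
    [NormedAddCommGroup F] [NormedSpace ℝ F] {ψ : E → F} {x v : ℝ → E} {x' v' : E} {t : ℝ}
    (hψ : ContDiffAt ℝ 2 ψ (x t)) (hx : HasDerivAt x x' t) (hv : HasDerivAt v v' t) :
    HasDerivAt (fun τ ↦ fderiv ℝ ψ (x τ) (v τ))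
      (fderiv ℝ (fderiv ℝ ψ) (x t) x' (v t) + fderiv ℝ ψ (x t) v') t :=
  (((hψ.fderiv_right (m := 1) (by norm_num)).differentiableAt
    one_ne_zero).hasFDerivAt.comp_hasDerivAt t hx).clm_apply hv

end CurvesInNormedSpaces

section CoordinatesAlongCurves

lemma chart_comp_eventuallyEq {E : Type*} [NormedAddCommGroup E] {M : Type*} [TopologicalSpace M]
    [ChartedSpace E M] {γ : ℝ → M} {t : ℝ} {x₀ : M} (x₁ : M)
    (h₀ : γ t ∈ (chartAt E x₀).source) (hγ : ContinuousAt γ t) :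
    (chartAt E x₁ ∘ γ : ℝ → E) =ᶠ[𝓝 t] transition x₀ x₁ ∘ (chartAt E x₀ ∘ γ) :=
  (hγ.eventually_mem ((chartAt E x₀).open_source.mem_nhds h₀)).mono fun _ hτ ↦
    (transition_chart hτ).symm

variable {E : Type*} [NormedAddCommGroup E] [NormedSpace ℝ E] {M : Type*} [TopologicalSpace M]
  [ChartedSpace E M] {γ : ℝ → M} {t : ℝ} {x₀ x₁ : M}

/-- The coordinates of position and velocity of a curve in the chart at `x₀`. -/
def chartState (x₀ : M) (γ : ℝ → M) (t : ℝ) : E × E :=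
  (chartAt E x₀ (γ t), deriv (chartAt E x₀ ∘ γ) t)

lemma chartState_eventuallyEq {γ' : ℝ → M} (h : γ' =ᶠ[𝓝 t] γ) (x₀ : M) :
    chartState (E := E) x₀ γ' =ᶠ[𝓝 t] chartState x₀ γ := by
  have hchart : (chartAt E x₀ ∘ γ' : ℝ → E) =ᶠ[𝓝 t] chartAt E x₀ ∘ γ := h.fun_comp _
  exact hchart.prodMk hchart.deriv

lemma hasDerivAt_chart_of_chartState {z' : E × E} (h : HasDerivAt (chartState x₀ γ) z' t) :
    HasDerivAt (chartAt E x₀ ∘ γ) z'.1 t :=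
  (ContinuousLinearMap.fst ℝ E E).hasFDerivAt.comp_hasDerivAt t h

lemma hasDerivAt_deriv_chart_of_chartState {z' : E × E}
    (h : HasDerivAt (chartState x₀ γ) z' t) :
    HasDerivAt (deriv (chartAt E x₀ ∘ γ : ℝ → E)) z'.2 t :=
  (ContinuousLinearMap.snd ℝ E E).hasFDerivAt.comp_hasDerivAt t h

lemma chartState_chart_symm {X : ℝ → E × E} {z' : E × E}
    (hmem : ∀ᶠ τ in 𝓝 t, (X τ).1 ∈ (chartAt E x₀).target) (hX : HasDerivAt X z' t) :
    chartState (E := E) x₀ (fun τ ↦ (chartAt E x₀).symm (X τ).1) t = ((X t).1, z'.1) := by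
  have hchart : (chartAt E x₀ ∘ fun τ ↦ (chartAt E x₀).symm (X τ).1) =ᶠ[𝓝 t] fun τ ↦ (X τ).1 :=
    hmem.mono fun τ hτ ↦ (chartAt E x₀).right_inv hτ
  exact Prod.ext hchart.self_of_nhds (hchart.deriv_eq.trans
    ((ContinuousLinearMap.fst ℝ E E).hasFDerivAt.comp_hasDerivAt t hX).deriv)

variable [IsManifold 𝓘(ℝ, E) ∞ M]

lemma hasDerivAt_chart_comp {x' : E} (h₀ : γ t ∈ (chartAt E x₀).source)
    (h₁ : γ t ∈ (chartAt E x₁).source) (hγ : ContinuousAt γ t)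
    (hx : HasDerivAt (chartAt E x₀ ∘ γ) x' t) :
    HasDerivAt (chartAt E x₁ ∘ γ) (fderiv ℝ (transition x₀ x₁) (chartAt E x₀ (γ t)) x') t :=
  (((contDiffAt_transition h₀ h₁).differentiableAt (by simp)).hasFDerivAt.comp_hasDerivAt t
    hx).congr_of_eventuallyEq (chart_comp_eventuallyEq x₁ h₀ hγ)

lemma chartDeriv_comp_eventuallyEq (V : ∀ t, TangentSpace 𝓘(ℝ, E) (γ t))
    (h₀ : γ t ∈ (chartAt E x₀).source) (h₁ : γ t ∈ (chartAt E x₁).source)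
    (hγ : ContinuousAt γ t) :
    (fun τ ↦ chartDeriv (E := E) x₁ (γ τ) (V τ)) =ᶠ[𝓝 t] fun τ ↦
      fderiv ℝ (transition x₀ x₁) (chartAt E x₀ (γ τ)) (chartDeriv (E := E) x₀ (γ τ) (V τ)) := by
  filter_upwards [hγ.eventually_mem ((chartAt E x₀).open_source.mem_nhds h₀),
    hγ.eventually_mem ((chartAt E x₁).open_source.mem_nhds h₁)] with τ hτ₀ hτ₁
  rw [← fderiv_transition_comp_chartDeriv hτ₀ hτ₁]
  rfl

lemma chartDeriv_fderiv_transition {m : M} (hm : m ∈ (chartAt E x₀).source) (e : E) :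
    chartDeriv x₀ m (fderiv ℝ (transition x₀ m) (chartAt E x₀ m) e) = e := by
  rw [fderiv_transition hm (mem_chart_source E m), chartDeriv_self, ContinuousLinearMap.id_comp]
  exact DFunLike.congr_fun (chartDeriv_comp_chartSymmDeriv hm) e

lemma chartDeriv_velocity (h₀ : γ t ∈ (chartAt E x₀).source)
    (hγ : MDifferentiableAt 𝓘(ℝ, ℝ) 𝓘(ℝ, E) γ t) :
    chartDeriv (E := E) x₀ (γ t) (velocity γ t) = deriv (chartAt E x₀ ∘ γ) t := by
  have h := mfderiv_comp (I := 𝓘(ℝ, ℝ)) (I' := 𝓘(ℝ, E)) (I'' := 𝓘(ℝ, E)) t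
    ((mdifferentiable_chartAt x₀).mdifferentiableAt h₀) hγ
  rw [mfderiv_eq_fderiv] at h
  rw [← fderiv_apply_one_eq_deriv]
  exact (DFunLike.congr_fun h (1 : ℝ)).symm

lemma mk_velocity_eq_iff {q : M} {v : TangentSpace 𝓘(ℝ, E) q} {γ : ℝ → M} {t : ℝ}
    (hγ : MDifferentiableAt 𝓘(ℝ, ℝ) 𝓘(ℝ, E) γ t) :
    (⟨γ t, velocity γ t⟩ : TangentBundle 𝓘(ℝ, E) M) = ⟨q, v⟩ ↔
      γ t = q ∧ chartState (E := E) q γ t = (chartAt E q q, v) := by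
  have hvelocity : (velocity γ t : E) = deriv (chartAt E (γ t) ∘ γ) t := by
    rw [← chartDeriv_velocity (mem_chart_source E (γ t)) hγ, chartDeriv_self]
    rfl
  constructor
  · intro h
    obtain rfl : γ t = q := congrArg TotalSpace.proj h
    have hv : velocity γ t = v := eq_of_heq ((TotalSpace.mk.injEq _ _ _ _).mp h).2
    exact ⟨rfl, Prod.ext rfl (hvelocity.symm.trans hv)⟩
  · rintro ⟨rfl, h⟩
    exact congrArg (TotalSpace.mk (γ t)) (hvelocity.trans (congrArg Prod.snd h))

lemma contDiffAt_chart_comp {n : ℕ∞} (hγ : ContMDiffAt 𝓘(ℝ, ℝ) 𝓘(ℝ, E) n γ t)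
    (h₀ : γ t ∈ (chartAt E x₀).source) : ContDiffAt ℝ n (chartAt E x₀ ∘ γ : ℝ → E) t := by
  rw [← contMDiffAt_iff_contDiffAt]
  exact ((contMDiffAt_chart h₀).of_le (by exact_mod_cast le_top)).comp t hγ

lemma hasDerivAt_chartState (hγ : ContMDiffAt 𝓘(ℝ, ℝ) 𝓘(ℝ, E) 2 γ t)
    (h₀ : γ t ∈ (chartAt E x₀).source) :
    HasDerivAt (chartState x₀ γ)
      (deriv (chartAt E x₀ ∘ γ : ℝ → E) t, deriv (deriv (chartAt E x₀ ∘ γ)) t) t := by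
  have hx : ContDiffAt ℝ 2 (chartAt E x₀ ∘ γ : ℝ → E) t := contDiffAt_chart_comp (n := 2) hγ h₀
  have hx' : ContDiffAt ℝ 1 (fun τ ↦ fderiv ℝ (chartAt E x₀ ∘ γ : ℝ → E) τ 1) t :=
    (hx.fderiv_right (m := 1) (by norm_num)).clm_apply contDiffAt_const
  simp only [fderiv_apply_one_eq_deriv] at hx'
  exact (hx.differentiableAt two_ne_zero).hasDerivAt.prodMk
    (hx'.differentiableAt one_ne_zero).hasDerivAt

/-- The change of coordinates from the chart at `x₀` to the chart at `x₁`, on tangent vectors. -/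
def stateTransition (x₀ x₁ : M) (z : E × E) : E × E :=
  (transition x₀ x₁ z.1, fderiv ℝ (transition x₀ x₁) z.1 z.2)

lemma contDiffAt_stateTransition {m : M} {v : E} (h₀ : m ∈ (chartAt E x₀).source)
    (h₁ : m ∈ (chartAt E x₁).source) :
    ContDiffAt ℝ 1 (stateTransition (E := E) x₀ x₁) (chartAt E x₀ m, v) := by
  have hψ : ContDiffAt ℝ ∞ (transition x₀ x₁ : E → E) ((chartAt E x₀ m, v) : E × E).1 :=
    contDiffAt_transition h₀ h₁
  exact ((hψ.of_le (by norm_cast)).comp (chartAt E x₀ m, v) contDiffAt_fst).prodMk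
    (((hψ.fderiv_right (m := 1) (by norm_cast)).comp (chartAt E x₀ m, v)
      contDiffAt_fst).clm_apply contDiffAt_snd)

end CoordinatesAlongCurves

section GeodesicEquation

variable {E : Type*} [NormedAddCommGroup E] [NormedSpace ℝ E] {M : Type*} [TopologicalSpace M]
  [ChartedSpace E M] [RiemannianBundle (fun x : M ↦ TangentSpace 𝓘(ℝ, E) x)]

lemma christoffel_eq_christoffelForm (x₀ : M) (y u w : E) :
    christoffel x₀ y u w = christoffelForm (metricInChart x₀) y u w := rfl

/-- The geodesic spray in the chart at `x₀`. -/
def spray (x₀ : M) (z : E × E) : E × E := (z.2, -christoffel x₀ z.1 z.2 z.2)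

/-- Near time `t`, the curve `γ` lies in the domain of the chart at `x₀` and solves the geodesic
equation there. -/
def SolvesGeodesicEq (x₀ : M) (γ : ℝ → M) (t : ℝ) : Prop :=
  ∀ᶠ τ in 𝓝 t, γ τ ∈ (chartAt E x₀).source ∧ ContinuousAt γ τ ∧
    HasDerivAt (chartState (E := E) x₀ γ) (spray x₀ (chartState x₀ γ τ)) τ

lemma SolvesGeodesicEq.eventually {x₀ : M} {γ : ℝ → M} {t : ℝ}
    (h : SolvesGeodesicEq (E := E) x₀ γ t) :
    ∀ᶠ τ in 𝓝 t, SolvesGeodesicEq (E := E) x₀ γ τ := eventually_eventually_nhds.2 h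

lemma SolvesGeodesicEq.congr {x₀ : M} {γ γ' : ℝ → M} {t : ℝ}
    (h : SolvesGeodesicEq (E := E) x₀ γ t) (he : γ' =ᶠ[𝓝 t] γ) :
    SolvesGeodesicEq (E := E) x₀ γ' t := by
  filter_upwards [h, he.eventuallyEq_nhds] with τ ⟨hmem, hcont, hstate⟩ heτ
  have hstate' := chartState_eventuallyEq (E := E) heτ x₀
  refine ⟨heτ.self_of_nhds ▸ hmem, hcont.congr heτ.symm, ?_⟩
  rw [hstate'.self_of_nhds]
  exact hstate.congr_of_eventuallyEq hstate'

variable [IsManifold 𝓘(ℝ, E) ∞ M]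

lemma SolvesGeodesicEq.chartState_eq {x₀ x₁ : M} {γ : ℝ → M} {t : ℝ}
    (h : SolvesGeodesicEq (E := E) x₀ γ t) (h₁ : γ t ∈ (chartAt E x₁).source) :
    chartState (E := E) x₁ γ t = stateTransition x₀ x₁ (chartState x₀ γ t) := by
  obtain ⟨hmem, hcont, hstate⟩ := h.self_of_nhds
  exact Prod.ext (transition_chart hmem).symm
    (hasDerivAt_chart_comp hmem h₁ hcont (hasDerivAt_chart_of_chartState hstate)).deriv

lemma eventually_metricInChart_transition {x₀ x₁ m : M} (h₀ : m ∈ (chartAt E x₀).source)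
    (h₁ : m ∈ (chartAt E x₁).source) :
    ∀ᶠ y in 𝓝 (chartAt E x₀ m), ∀ u w, metricInChart x₀ y u w =
      metricInChart x₁ (transition x₀ x₁ y)
        (fderiv ℝ (transition x₀ x₁) y u) (fderiv ℝ (transition x₀ x₁) y w) := by
  have hy₀ := (chartAt E x₀).map_source h₀
  have hsource : ∀ᶠ y in 𝓝 (chartAt E x₀ m), (chartAt E x₀).symm y ∈ (chartAt E x₁).source :=
    ((chartAt E x₀).continuousAt_symm hy₀).eventually_mem <| by
      rw [(chartAt E x₀).left_inv h₀]
      exact (chartAt E x₁).open_source.mem_nhds h₁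
  filter_upwards [hsource, (chartAt E x₀).open_target.mem_nhds hy₀] with y hy hytarget u w
  have h := metricInChart_transition ((chartAt E x₀).map_target hytarget) hy u w
  rwa [(chartAt E x₀).right_inv hytarget] at h

variable [FiniteDimensional ℝ E]
  [IsContMDiffRiemannianBundle 𝓘(ℝ, E) ∞ E (fun x : M ↦ TangentSpace 𝓘(ℝ, E) x)]

lemma contDiffAt_metricInChart {x₀ : M} {y : E} (hy : y ∈ (chartAt E x₀).target) :
    ContDiffAt ℝ ∞ (metricInChart (E := E) x₀) y :=
  (contDiffOn_metricInChart x₀).contDiffAt ((chartAt E x₀).open_target.mem_nhds hy)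

lemma contDiffAt_christoffelForm_metricInChart {x₀ : M} {y : E}
    (hy : y ∈ (chartAt E x₀).target) :
    ContDiffAt ℝ ∞ (christoffelForm (metricInChart (E := E) x₀)) y :=
  have : CompleteSpace E := FiniteDimensional.complete ℝ E
  contDiffAt_christoffelForm (contDiffAt_metricInChart hy) (isInvertible_metricInChart hy)

lemma christoffel_symm {x₀ : M} {y : E} (hy : y ∈ (chartAt E x₀).target) (u w : E) :
    christoffel x₀ y u w = christoffel x₀ y w u :=
  christoffelForm_symm ((contDiffAt_metricInChart hy).differentiableAt (by simp))
    (.of_forall fun y ↦ metricInChart_comm x₀ y) u w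

lemma fderiv_transition_christoffel {x₀ x₁ m : M} (h₀ : m ∈ (chartAt E x₀).source)
    (h₁ : m ∈ (chartAt E x₁).source) (u w : E) :
    fderiv ℝ (transition x₀ x₁) (chartAt E x₀ m) (christoffel x₀ (chartAt E x₀ m) u w) =
      christoffel x₁ (chartAt E x₁ m) (fderiv ℝ (transition x₀ x₁) (chartAt E x₀ m) u)
        (fderiv ℝ (transition x₀ x₁) (chartAt E x₀ m) w)
        + fderiv ℝ (fderiv ℝ (transition x₀ x₁)) (chartAt E x₀ m) u w := by
  have hy₀ := (chartAt E x₀).map_source h₀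
  have hy₁ := (chartAt E x₁).map_source h₁
  rw [← transition_chart (x₀ := x₀) h₀] at hy₁
  rw [← transition_chart (x₀ := x₀) (x₁ := x₁) h₀]
  refine fderiv_christoffelForm_eq_add ((contDiffAt_transition h₀ h₁).of_le (by norm_cast)) ?_
    ((contDiffAt_metricInChart hy₀).differentiableAt (by simp))
    ((contDiffAt_metricInChart hy₁).differentiableAt (by simp))
    (isInvertible_metricInChart hy₀) (isInvertible_metricInChart hy₁) (metricInChart_comm x₁ _)
    (eventually_metricInChart_transition h₀ h₁) u w
  rw [fderiv_transition h₀ h₁]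
  exact ((isInvertible_chartDeriv h₁).comp (isInvertible_chartSymmDeriv h₀)).surjective

/-- The coordinate formula for the covariant derivative does not depend on the chart. -/
lemma chartDeriv_covDerivAlong {γ : ℝ → M} {V : ∀ t, TangentSpace 𝓘(ℝ, E) (γ t)} {t : ℝ}
    {x₀ : M} {x' v' : E} (h₀ : γ t ∈ (chartAt E x₀).source) (hγ : ContinuousAt γ t)
    (hx : HasDerivAt (chartAt E x₀ ∘ γ) x' t)
    (hv : HasDerivAt (fun τ ↦ chartDeriv (E := E) x₀ (γ τ) (V τ)) v' t) :
    chartDeriv (E := E) x₀ (γ t) (covDerivAlong γ V t) =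
      v' + christoffel x₀ (chartAt E x₀ (γ t)) x' (chartDeriv (E := E) x₀ (γ t) (V t)) := by
  have h₁ : γ t ∈ (chartAt E (γ t)).source := mem_chart_source E (γ t)
  have hcov : (covDerivAlong γ V t : E) =
      deriv (fun τ ↦ chartDeriv (E := E) (γ t) (γ τ) (V τ)) t +
        christoffel (γ t) (chartAt E (γ t) (γ t)) (deriv (chartAt E (γ t) ∘ γ) t)
          (chartDeriv (E := E) (γ t) (γ t) (V t)) := rfl
  have hV := chartDeriv_comp_eventuallyEq V h₀ h₁ hγ
  have hVt : chartDeriv (E := E) (γ t) (γ t) (V t) = fderiv ℝ (transition x₀ (γ t))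
      (chartAt E x₀ (γ t)) (chartDeriv (E := E) x₀ (γ t) (V t)) := hV.self_of_nhds
  have hderiv : HasDerivAt (fun τ ↦ fderiv ℝ (transition x₀ (γ t)) (chartAt E x₀ (γ τ))
        (chartDeriv (E := E) x₀ (γ τ) (V τ)))
      (fderiv ℝ (fderiv ℝ (transition x₀ (γ t))) (chartAt E x₀ (γ t)) x'
        (chartDeriv (E := E) x₀ (γ t) (V t)) +
          fderiv ℝ (transition x₀ (γ t)) (chartAt E x₀ (γ t)) v') t :=
    hasDerivAt_fderiv_apply (x := chartAt E x₀ ∘ γ)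
      ((contDiffAt_transition h₀ h₁).of_le (by norm_cast)) hx hv
  have htransition : (covDerivAlong γ V t : E) =
      fderiv ℝ (transition x₀ (γ t)) (chartAt E x₀ (γ t))
        (v' + christoffel x₀ (chartAt E x₀ (γ t)) x' (chartDeriv (E := E) x₀ (γ t) (V t))) := by
    rw [hcov, hV.deriv_eq, hderiv.deriv, (hasDerivAt_chart_comp h₀ h₁ hγ hx).deriv, hVt, map_add,
      fderiv_transition_christoffel h₀ h₁]
    abel
  exact (congrArg (chartDeriv (E := E) x₀ (γ t)) htransition).trans
    (chartDeriv_fderiv_transition h₀ _)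

lemma covDerivAlong_velocity_eq_zero_iff {γ : ℝ → M} {t : ℝ} {x₀ : M} {z' : E × E}
    (hγ : ∀ᶠ τ in 𝓝 t, γ τ ∈ (chartAt E x₀).source ∧ MDifferentiableAt 𝓘(ℝ, ℝ) 𝓘(ℝ, E) γ τ)
    (hstate : HasDerivAt (chartState (E := E) x₀ γ) z' t) :
    covDerivAlong (E := E) γ (velocity γ) t = 0 ↔ z' = spray x₀ (chartState x₀ γ t) := by
  obtain ⟨hmem, hdiff⟩ := hγ.self_of_nhds
  have hvelocity : (fun τ ↦ chartDeriv (E := E) x₀ (γ τ) (velocity (E := E) γ τ)) =ᶠ[𝓝 t]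
      deriv (chartAt E x₀ ∘ γ : ℝ → E) := hγ.mono fun τ hτ ↦ chartDeriv_velocity hτ.1 hτ.2
  have hfst : z'.1 = (chartState x₀ γ t).2 := (hasDerivAt_chart_of_chartState hstate).deriv.symm
  have hcov := chartDeriv_covDerivAlong hmem hdiff.continuousAt
    (hasDerivAt_chart_of_chartState hstate)
    ((hasDerivAt_deriv_chart_of_chartState hstate).congr_of_eventuallyEq hvelocity)
  rw [show chartDeriv (E := E) x₀ (γ t) (velocity (E := E) γ t) = (chartState x₀ γ t).2 from
    hvelocity.self_of_nhds, hfst] at hcov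
  rw [Prod.ext_iff, spray, and_iff_right hfst, eq_neg_iff_add_eq_zero]
  exact (map_eq_zero_iff _ (isInvertible_chartDeriv hmem).injective).symm.trans
    (Eq.congr_left hcov)

lemma contDiffAt_spray {x₀ : M} {z : E × E} (hz : z.1 ∈ (chartAt E x₀).target) :
    ContDiffAt ℝ ∞ (spray (E := E) x₀) z := by
  have hΓ : ContDiffAt ℝ ∞ (fun z : E × E ↦ christoffelForm (metricInChart (E := E) x₀) z.1) z :=
    (contDiffAt_christoffelForm_metricInChart hz).comp z contDiffAt_fst
  exact contDiffAt_snd.prodMk ((hΓ.clm_apply contDiffAt_snd).clm_apply contDiffAt_snd).neg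

lemma fderiv_spray {x₀ : M} {z : E × E} (hz : z.1 ∈ (chartAt E x₀).target) (j : E × E) :
    fderiv ℝ (spray (E := E) x₀) z j =
      (j.2, -(fderiv ℝ (christoffelForm (metricInChart (E := E) x₀)) z.1 j.1 z.2 z.2
        + christoffel x₀ z.1 j.2 z.2 + christoffel x₀ z.1 z.2 j.2)) := by
  have hΓ : HasFDerivAt (fun z : E × E ↦ christoffelForm (metricInChart (E := E) x₀) z.1)
      ((fderiv ℝ (christoffelForm (metricInChart (E := E) x₀)) z.1).comp
        (ContinuousLinearMap.fst ℝ E E)) z :=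
    ((contDiffAt_christoffelForm_metricInChart hz).differentiableAt (by simp)).hasFDerivAt.comp z
      hasFDerivAt_fst
  have hspray : HasFDerivAt (spray (E := E) x₀) _ z :=
    hasFDerivAt_snd.prodMk ((hΓ.clm_apply hasFDerivAt_snd).clm_apply hasFDerivAt_snd).neg
  rw [hspray.fderiv]
  simp only [ContinuousLinearMap.prod_apply, ContinuousLinearMap.coe_snd', neg_apply,
    add_apply, ContinuousLinearMap.comp_apply, ContinuousLinearMap.flip_apply,
    ContinuousLinearMap.coe_fst', christoffel_eq_christoffelForm]
  congr 2
  abel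

lemma IsGeodesicOn.solvesGeodesicEq {γ : ℝ → M} {s : Set ℝ} (hs : IsOpen s)
    (h : IsGeodesicOn (E := E) γ s) {t : ℝ} (ht : t ∈ s) {x₀ : M}
    (h₀ : γ t ∈ (chartAt E x₀).source) : SolvesGeodesicEq (E := E) x₀ γ t := by
  have hC : ∀ τ ∈ s, ContMDiffAt 𝓘(ℝ, ℝ) 𝓘(ℝ, E) 2 γ τ := fun τ hτ ↦
    h.1.contMDiffAt (hs.mem_nhds hτ)
  have hnear : ∀ᶠ τ in 𝓝 t, τ ∈ s ∧ γ τ ∈ (chartAt E x₀).source :=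
    (hs.eventually_mem ht).and ((hC t ht).continuousAt.eventually_mem
      ((chartAt E x₀).open_source.mem_nhds h₀))
  filter_upwards [hnear, eventually_eventually_nhds.2 hnear] with τ hτ hnearτ
  have hstate := hasDerivAt_chartState (hC τ hτ.1) hτ.2
  have hspray := (covDerivAlong_velocity_eq_zero_iff (hnearτ.mono fun σ hσ ↦
    ⟨hσ.2, (hC σ hσ.1).mdifferentiableAt two_ne_zero⟩) hstate).1 (h.2 τ hτ.1)
  exact ⟨hτ.2, (hC τ hτ.1).continuousAt, hspray ▸ hstate⟩

lemma SolvesGeodesicEq.contDiffAt_chartState {x₀ : M} {γ : ℝ → M} {t : ℝ}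
    (h : SolvesGeodesicEq (E := E) x₀ γ t) : ContDiffAt ℝ 1 (chartState (E := E) x₀ γ) t := by
  have hderiv := h.mono fun _ hτ ↦ hτ.2.2
  have hspray := contDiffAt_spray (z := chartState (E := E) x₀ γ t)
    ((chartAt E x₀).map_source h.self_of_nhds.1)
  exact contDiffAt_succ_of_hasDerivAt hderiv
    ((hspray.of_le (by simp)).comp t (contDiffAt_zero_of_hasDerivAt hderiv))

lemma SolvesGeodesicEq.contDiffAt {x₀ : M} {γ : ℝ → M} {t : ℝ}
    (h : SolvesGeodesicEq (E := E) x₀ γ t) :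
    ContDiffAt ℝ 2 (chartAt E x₀ ∘ γ : ℝ → E) t :=
  contDiffAt_succ_of_hasDerivAt (h.mono fun _ hτ ↦ hasDerivAt_chart_of_chartState hτ.2.2)
    h.contDiffAt_chartState.snd

lemma SolvesGeodesicEq.contMDiffAt {x₀ : M} {γ : ℝ → M} {t : ℝ}
    (h : SolvesGeodesicEq (E := E) x₀ γ t) : ContMDiffAt 𝓘(ℝ, ℝ) 𝓘(ℝ, E) 2 γ t := by
  have hsymm : ContMDiffAt 𝓘(ℝ, ℝ) 𝓘(ℝ, E) 2
      ((chartAt E x₀).symm ∘ (chartAt E x₀ ∘ γ)) t :=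
    ((contMDiffAt_chart_symm ((chartAt E x₀).map_source h.self_of_nhds.1)).of_le
      (by norm_cast)).comp t (contMDiffAt_iff_contDiffAt.2 h.contDiffAt)
  exact hsymm.congr_of_eventuallyEq (h.mono fun τ hτ ↦ ((chartAt E x₀).left_inv hτ.1).symm)

lemma isGeodesicOn_of_solvesGeodesicEq {γ : ℝ → M} {s : Set ℝ}
    (h : ∀ t ∈ s, ∃ x₀ : M, SolvesGeodesicEq (E := E) x₀ γ t) : IsGeodesicOn (E := E) γ s := by
  refine ⟨fun t ht ↦ ?_, fun t ht ↦ ?_⟩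
  · obtain ⟨x₀, hx₀⟩ := h t ht
    exact hx₀.contMDiffAt.contMDiffWithinAt
  · obtain ⟨x₀, hx₀⟩ := h t ht
    exact (covDerivAlong_velocity_eq_zero_iff (hx₀.eventually.mono fun τ hτ ↦
      ⟨hτ.self_of_nhds.1, hτ.contMDiffAt.mdifferentiableAt two_ne_zero⟩)
      hx₀.self_of_nhds.2.2).2 rfl

lemma SolvesGeodesicEq.change_chart {x₀ x₁ : M} {γ : ℝ → M} {t : ℝ}
    (h : SolvesGeodesicEq (E := E) x₀ γ t) (h₁ : γ t ∈ (chartAt E x₁).source) :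
    SolvesGeodesicEq (E := E) x₁ γ t := by
  obtain ⟨u, hu, huo, htu⟩ := eventually_nhds_iff.1 h.eventually
  exact (isGeodesicOn_of_solvesGeodesicEq fun τ hτ ↦ ⟨x₀, hu τ hτ⟩).solvesGeodesicEq huo htu h₁

end GeodesicEquation

lemma exists_pos_Ioo_subset_of_Icc_subset {U : Set ℝ} {a b : ℝ} (hab : a ≤ b) (hU : IsOpen U)
    (h : Icc a b ⊆ U) : ∃ ε > 0, Ioo (a - ε) (b + ε) ⊆ U := by
  obtain ⟨ε, hε, hεU⟩ := isCompact_Icc.exists_thickening_subset_open hU h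
  refine ⟨ε, hε, fun t ht ↦ hεU (Metric.mem_thickening_iff.2 ?_)⟩
  refine ⟨max a (min b t), ⟨le_max_left _ _, max_le hab (min_le_left _ _)⟩, ?_⟩
  rw [Real.dist_eq, abs_lt]
  grind

section AffineReparametrization

variable {E : Type*} [NormedAddCommGroup E] [NormedSpace ℝ E] {M : Type*} [TopologicalSpace M]
  [ChartedSpace E M]

lemma chartState_comp_mul_add (x₀ : M) (γ : ℝ → M) (a b t : ℝ) :
    chartState (E := E) x₀ (fun τ ↦ γ (a * τ + b)) t =
      ((chartState (E := E) x₀ γ (a * t + b)).1, a • (chartState (E := E) x₀ γ (a * t + b)).2) :=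
  Prod.ext rfl <| (deriv_comp_mul_left a (fun τ ↦ (chartAt E x₀ ∘ γ : ℝ → E) (τ + b)) t).trans
    (congrArg (a • ·) (deriv_comp_add_const _ b (a * t)))

variable [RiemannianBundle (fun x : M ↦ TangentSpace 𝓘(ℝ, E) x)]

lemma SolvesGeodesicEq.comp_mul_add {x₀ : M} {γ : ℝ → M} {a b t : ℝ}
    (h : SolvesGeodesicEq (E := E) x₀ γ (a * t + b)) :
    SolvesGeodesicEq (E := E) x₀ (fun τ ↦ γ (a * τ + b)) t := by
  have hcont : Continuous fun τ : ℝ ↦ a * τ + b := by fun_prop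
  filter_upwards [hcont.continuousAt.eventually h] with τ ⟨hmem, hγ, hstate⟩
  refine ⟨hmem, ContinuousAt.comp (f := fun τ : ℝ ↦ a * τ + b) hγ hcont.continuousAt, ?_⟩
  have haffine : HasDerivAt (fun τ : ℝ ↦ a * τ + b) a τ := by
    simpa using ((hasDerivAt_id τ).const_mul a).add_const b
  have hscaled := (HasDerivAt.scomp (h := fun τ ↦ a * τ + b) τ
    (hasDerivAt_chart_of_chartState hstate) haffine).prodMk
      ((HasDerivAt.scomp (h := fun τ ↦ a * τ + b) τ
        (hasDerivAt_deriv_chart_of_chartState hstate) haffine).const_smul a)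
  rw [show chartState (E := E) x₀ (fun τ ↦ γ (a * τ + b)) = _ from
    funext fun τ ↦ chartState_comp_mul_add x₀ γ a b τ]
  refine hscaled.congr_deriv ?_
  simp only [spray, christoffel_eq_christoffelForm, map_smul, smul_apply, smul_neg]

/-- `γ` is a geodesic on the open interval `(a, b)` around `0` that starts from `q` with
velocity `v`. -/
structure IsGeodesicFromOn (q : M) (v : E) (γ : ℝ → M) (a b : ℝ) : Prop where
  zero_mem : (0 : ℝ) ∈ Ioo a b
  solves : ∀ t ∈ Ioo a b, ∃ x₀ : M, SolvesGeodesicEq (E := E) x₀ γ t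
  start : γ 0 = q
  chartState_zero : chartState (E := E) q γ 0 = (chartAt E q q, v)

lemma IsGeodesicFromOn.comp_mul {q : M} {v : E} {γ : ℝ → M} {a b T : ℝ}
    (h : IsGeodesicFromOn q v γ a b) (hT : T ∈ Ioo a b) :
    ∃ ε > 0, IsGeodesicFromOn q (T • v) (fun τ ↦ γ (T * τ)) (0 - ε) (1 + ε) := by
  have hIcc : Icc 0 1 ⊆ (fun τ : ℝ ↦ T * τ) ⁻¹' Ioo a b := fun τ hτ ↦ by
    simpa [mul_comm] using
      (convex_Ioo a b) h.zero_mem hT (sub_nonneg.2 hτ.2) hτ.1 (sub_add_cancel 1 τ)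
  obtain ⟨ε, hε, hmem⟩ := exists_pos_Ioo_subset_of_Icc_subset zero_le_one
    (isOpen_Ioo.preimage (by fun_prop)) hIcc
  have haffine : (fun τ ↦ γ (T * τ)) = fun τ ↦ γ (T * τ + 0) := by simp only [add_zero]
  refine ⟨ε, hε, ⟨by linarith, by linarith⟩, fun τ hτ ↦ ?_, by simpa using h.start, ?_⟩
  · obtain ⟨x₀, hx₀⟩ := h.solves _ (hmem hτ)
    exact ⟨x₀, haffine ▸ SolvesGeodesicEq.comp_mul_add (by simpa using hx₀)⟩
  · rw [haffine, chartState_comp_mul_add, mul_zero, add_zero, h.chartState_zero]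

end AffineReparametrization

section Geodesics

variable {E : Type*} [NormedAddCommGroup E] [NormedSpace ℝ E] [FiniteDimensional ℝ E]
  {M : Type*} [TopologicalSpace M] [ChartedSpace E M] [IsManifold 𝓘(ℝ, E) ∞ M]
  [RiemannianBundle (fun x : M ↦ TangentSpace 𝓘(ℝ, E) x)]
  [IsContMDiffRiemannianBundle 𝓘(ℝ, E) ∞ E (fun x : M ↦ TangentSpace 𝓘(ℝ, E) x)]

lemma SolvesGeodesicEq.eventuallyEq {x₀ : M} {γ γ' : ℝ → M} {t : ℝ}
    (h : SolvesGeodesicEq (E := E) x₀ γ t) (h' : SolvesGeodesicEq (E := E) x₀ γ' t)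
    (heq : chartState (E := E) x₀ γ t = chartState x₀ γ' t) : γ =ᶠ[𝓝 t] γ' := by
  have hz : (chartState (E := E) x₀ γ t).1 ∈ (chartAt E x₀).target :=
    (chartAt E x₀).map_source h.self_of_nhds.1
  obtain ⟨K, s, hs, hlip⟩ :=
    ((contDiffAt_spray hz).of_le (by norm_cast : (1 : ℕ∞ω) ≤ ∞)).exists_lipschitzOnWith
  have hcont := h.self_of_nhds.2.2.continuousAt
  have hcont' := h'.self_of_nhds.2.2.continuousAt
  have hstate : chartState (E := E) x₀ γ =ᶠ[𝓝 t] chartState x₀ γ' :=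
    ODE_solution_unique_of_eventually (v := fun _ ↦ spray x₀) (s := fun _ ↦ s) (K := K)
      (.of_forall fun _ ↦ hlip)
      ((h.and (hcont.eventually_mem hs)).mono fun _ hτ ↦ ⟨hτ.1.2.2, hτ.2⟩)
      ((h'.and (hcont'.eventually_mem (heq ▸ hs))).mono fun _ hτ ↦ ⟨hτ.1.2.2, hτ.2⟩) heq
  filter_upwards [h, h', hstate] with τ hτ hτ' hstateτ
  exact (chartAt E x₀).injOn hτ.1 hτ'.1 (congrArg Prod.fst hstateτ)

lemma SolvesGeodesicEq.eventually_not_eventuallyEq [T2Space M] {x₀ x₁ : M} {γ γ' : ℝ → M} {t : ℝ}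
    (h : SolvesGeodesicEq (E := E) x₀ γ t) (h' : SolvesGeodesicEq (E := E) x₁ γ' t)
    (hne : ¬ γ =ᶠ[𝓝 t] γ') : ∀ᶠ τ in 𝓝 t, ¬ γ =ᶠ[𝓝 τ] γ' := by
  by_cases hpoint : γ t = γ' t
  · have hmem : γ t ∈ (chartAt E (γ t)).source := mem_chart_source E (γ t)
    have hsolves : SolvesGeodesicEq (γ t) γ t := h.change_chart hmem
    have hsolves' : SolvesGeodesicEq (γ t) γ' t := h'.change_chart (hpoint ▸ hmem)
    have hstate : chartState (E := E) (γ t) γ t ≠ chartState (γ t) γ' t := fun heq ↦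
      hne (hsolves.eventuallyEq hsolves' heq)
    filter_upwards [(hsolves.self_of_nhds.2.2.continuousAt.ne_iff_eventually_ne
      hsolves'.self_of_nhds.2.2.continuousAt).1 hstate] with τ hτ heq
    exact hτ (chartState_eventuallyEq heq (γ t)).self_of_nhds
  · filter_upwards [(h.self_of_nhds.2.1.ne_iff_eventually_ne h'.self_of_nhds.2.1).1 hpoint]
      with τ hτ heq
    exact hτ heq.self_of_nhds

lemma eventuallyEq_of_solvesGeodesicEq [T2Space M] {γ γ' : ℝ → M} {s : Set ℝ}
    (hs : IsPreconnected s) (h : ∀ t ∈ s, ∃ x₀ : M, SolvesGeodesicEq (E := E) x₀ γ t)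
    (h' : ∀ t ∈ s, ∃ x₀ : M, SolvesGeodesicEq (E := E) x₀ γ' t) {t₀ : ℝ} (ht₀ : t₀ ∈ s)
    (heq : γ =ᶠ[𝓝 t₀] γ') {t : ℝ} (ht : t ∈ s) : γ =ᶠ[𝓝 t] γ' := by
  refine (hs.induction₂ (fun t t' ↦ (γ =ᶠ[𝓝 t] γ' ↔ γ =ᶠ[𝓝 t'] γ')) (fun t ht ↦ ?_)
    (fun _ _ _ _ _ _ h₁ h₂ ↦ h₁.trans h₂) (fun _ _ _ _ h ↦ h.symm) ht₀ ht).1 heq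
  apply nhdsWithin_le_nhds
  by_cases hagree : γ =ᶠ[𝓝 t] γ'
  · exact hagree.eventuallyEq_nhds.mono fun τ hτ ↦ iff_of_true hagree hτ
  · obtain ⟨x₀, hx₀⟩ := h t ht
    obtain ⟨x₁, hx₁⟩ := h' t ht
    exact (hx₀.eventually_not_eventuallyEq hx₁ hagree).mono fun τ hτ ↦ iff_of_false hagree hτ

lemma IsGeodesicFromOn.solvesGeodesicEq {q : M} {v : E} {γ : ℝ → M} {a b : ℝ}
    (h : IsGeodesicFromOn q v γ a b) {t : ℝ} (ht : t ∈ Ioo a b) {x₁ : M}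
    (h₁ : γ t ∈ (chartAt E x₁).source) : SolvesGeodesicEq (E := E) x₁ γ t :=
  have ⟨_, hx₀⟩ := h.solves t ht
  hx₀.change_chart h₁

lemma IsGeodesicFromOn.solvesGeodesicEq_zero {q : M} {v : E} {γ : ℝ → M} {a b : ℝ}
    (h : IsGeodesicFromOn q v γ a b) : SolvesGeodesicEq (E := E) q γ 0 :=
  h.solvesGeodesicEq h.zero_mem (h.start ▸ mem_chart_source E (γ 0))

lemma IsGeodesicFromOn.eventuallyEq [T2Space M] {q : M} {v : E} {γ γ' : ℝ → M} {a b a' b' : ℝ}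
    (h : IsGeodesicFromOn q v γ a b) (h' : IsGeodesicFromOn q v γ' a' b') {t : ℝ}
    (ht : t ∈ Ioo a b) (ht' : t ∈ Ioo a' b') : γ =ᶠ[𝓝 t] γ' :=
  eventuallyEq_of_solvesGeodesicEq (ordConnected_Ioo.inter ordConnected_Ioo).isPreconnected
    (fun t ht ↦ h.solves t ht.1) (fun t ht ↦ h'.solves t ht.2) ⟨h.zero_mem, h'.zero_mem⟩
    (h.solvesGeodesicEq_zero.eventuallyEq h'.solvesGeodesicEq_zero
      (h.chartState_zero.trans h'.chartState_zero.symm)) ⟨ht, ht'⟩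

lemma isGeodesicFrom_iff {q : M} {v : TangentSpace 𝓘(ℝ, E) q} {γ : ℝ → M} :
    IsGeodesicFrom q v γ ↔ ∃ ε > 0, IsGeodesicFromOn (E := E) q v γ (0 - ε) (1 + ε) := by
  constructor
  · rintro ⟨⟨ε, hε, hgeodesic⟩, hvelocity⟩
    have hzero : (0 : ℝ) ∈ Ioo (0 - ε) (1 + ε) := ⟨by linarith, by linarith⟩
    obtain ⟨hstart, hstate⟩ := (mk_velocity_eq_iff ((hgeodesic.1.contMDiffAt
      (isOpen_Ioo.mem_nhds hzero)).mdifferentiableAt two_ne_zero)).1 hvelocity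
    exact ⟨ε, hε, hzero, fun t ht ↦
      ⟨γ t, hgeodesic.solvesGeodesicEq isOpen_Ioo ht (mem_chart_source E (γ t))⟩, hstart, hstate⟩
  · rintro ⟨ε, hε, h⟩
    exact ⟨⟨ε, hε, isGeodesicOn_of_solvesGeodesicEq h.solves⟩,
      (mk_velocity_eq_iff (h.solvesGeodesicEq_zero.contMDiffAt.mdifferentiableAt two_ne_zero)).2
        ⟨h.start, h.chartState_zero⟩⟩

lemma IsGeodesicFromOn.smul_mem_expDomain {q : M} {v : TangentSpace 𝓘(ℝ, E) q} {γ : ℝ → M}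
    {a b T : ℝ} (h : IsGeodesicFromOn (E := E) q v γ a b) (hT : T ∈ Ioo a b) :
    T • v ∈ expDomain q :=
  ⟨_, isGeodesicFrom_iff.2 (h.comp_mul hT)⟩

lemma IsGeodesicFromOn.expMap_smul [T2Space M] {q : M} {v : TangentSpace 𝓘(ℝ, E) q} {γ : ℝ → M}
    {a b T : ℝ} (h : IsGeodesicFromOn (E := E) q v γ a b) (hT : T ∈ Ioo a b) :
    expMap q (T • v) = γ T := by
  have hex : ∃ γ : ℝ → M, IsGeodesicFrom q (T • v) γ := h.smul_mem_expDomain hT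
  obtain ⟨ε, hε, hscaled⟩ := h.comp_mul hT
  obtain ⟨ε', hε', hchosen⟩ := isGeodesicFrom_iff.1 hex.choose_spec
  have hone := (hchosen.eventuallyEq hscaled (t := 1) ⟨by linarith, by linarith⟩
    ⟨by linarith, by linarith⟩).self_of_nhds
  rw [expMap, dif_pos hex]
  exact hone.trans (congrArg γ (mul_one T))

end Geodesics

section GeodesicFlow

variable {E : Type*} [NormedAddCommGroup E] [NormedSpace ℝ E] {M : Type*} [TopologicalSpace M]
  [ChartedSpace E M] [RiemannianBundle (fun x : M ↦ TangentSpace 𝓘(ℝ, E) x)]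

lemma solvesGeodesicEq_of_hasDerivAt_spray {x₁ : M} {X : ℝ → E × E} {t : ℝ}
    (hX : ∀ᶠ τ in 𝓝 t, (X τ).1 ∈ (chartAt E x₁).target ∧ HasDerivAt X (spray x₁ (X τ)) τ) :
    SolvesGeodesicEq (E := E) x₁ (fun τ ↦ (chartAt E x₁).symm (X τ).1) t ∧
      chartState (E := E) x₁ (fun τ ↦ (chartAt E x₁).symm (X τ).1) t = X t := by
  have hstate : chartState (E := E) x₁ (fun τ ↦ (chartAt E x₁).symm (X τ).1) =ᶠ[𝓝 t] X :=
    hX.eventually_nhds.mono fun τ hτ ↦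
      chartState_chart_symm (hτ.mono fun _ hσ ↦ hσ.1) hτ.self_of_nhds.2
  refine ⟨?_, hstate.self_of_nhds⟩
  filter_upwards [hX, hstate.eventuallyEq_nhds] with τ ⟨hmem, hderiv⟩ hstateτ
  refine ⟨(chartAt E x₁).map_target hmem, ?_, ?_⟩
  · exact ContinuousAt.comp (f := fun τ ↦ (X τ).1) ((chartAt E x₁).continuousAt_symm hmem)
      (continuousAt_fst.comp hderiv.continuousAt)
  · rw [hstateτ.self_of_nhds]
    exact hderiv.congr_of_eventuallyEq hstateτ

/-- A local flow of the geodesic spray in the chart at `x₁`. -/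
abbrev IsGeodesicFlow (x₁ : M) (δ : ℝ) (W : Set (E × E)) (Φ : E × E → ℝ → E × E)
    (A : E × E → ℝ → E × E →L[ℝ] E × E) : Prop :=
  IsLocalFlow (spray x₁) (Prod.fst ⁻¹' (chartAt E x₁).target) δ W Φ A

/-- The curve in `M` that the flow `Φ`, in the chart at `x₁`, traces from the state `z` at
time `T`. -/
def flowCurve (x₁ : M) (Φ : E × E → ℝ → E × E) (z : E × E) (T t : ℝ) : M :=
  (chartAt E x₁).symm (Φ z (t - T)).1

lemma IsGeodesicFlow.solvesGeodesicEq_flowCurve {x₁ : M} {δ : ℝ} {W : Set (E × E)}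
    {Φ : E × E → ℝ → E × E} {A : E × E → ℝ → E × E →L[ℝ] E × E}
    (h : IsGeodesicFlow x₁ δ W Φ A) {z : E × E} (hz : z ∈ W) {T t : ℝ}
    (ht : t ∈ Ioo (T - δ) (T + δ)) :
    SolvesGeodesicEq (E := E) x₁ (flowCurve x₁ Φ z T) t ∧
      chartState (E := E) x₁ (flowCurve x₁ Φ z T) t = Φ z (t - T) := by
  refine solvesGeodesicEq_of_hasDerivAt_spray (X := fun t ↦ Φ z (t - T)) ?_
  filter_upwards [isOpen_Ioo.mem_nhds ht] with τ hτ
  have hτ' : τ - T ∈ Ioo (-δ) δ := ⟨by linarith [hτ.1], by linarith [hτ.2]⟩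
  exact ⟨h.mem z hz _ hτ', (h.hasDerivAt z hz _ hτ').comp_sub_const τ T⟩

lemma IsGeodesicFlow.isGeodesicFromOn_flowCurve {q : M} {δ : ℝ} {W : Set (E × E)}
    {Φ : E × E → ℝ → E × E} {A : E × E → ℝ → E × E →L[ℝ] E × E}
    (h : IsGeodesicFlow q δ W Φ A) {v : E} (hv : (chartAt E q q, v) ∈ W) :
    IsGeodesicFromOn q v (flowCurve q Φ (chartAt E q q, v) 0) (0 - δ) (0 + δ) := by
  have hzero : (0 : ℝ) ∈ Ioo (0 - δ) (0 + δ) := ⟨by linarith [h.pos], by linarith [h.pos]⟩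
  refine ⟨hzero, fun t ht ↦ ⟨q, (h.solvesGeodesicEq_flowCurve hv ht).1⟩, ?_, ?_⟩
  · rw [flowCurve, sub_zero, h.zero _ hv]
    exact (chartAt E q).left_inv (mem_chart_source E q)
  · rw [(h.solvesGeodesicEq_flowCurve hv hzero).2, sub_zero, h.zero _ hv]

end GeodesicFlow

section SmoothDependence

variable {E : Type*} [NormedAddCommGroup E] [NormedSpace ℝ E] {M : Type*} [TopologicalSpace M]
  [ChartedSpace E M] [RiemannianBundle (fun x : M ↦ TangentSpace 𝓘(ℝ, E) x)]

/-- The geodesics from `q` with initial velocity near `v₀` exist up to time `T`, where their states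
in the chart at `x₁` are a `C¹` function `G` of the initial velocity. -/
def IsGeodesicFamily (q : M) (v₀ : E) (x₁ : M) (T : ℝ) (G : E → E × E) : Prop :=
  ContDiffAt ℝ 1 G v₀ ∧ ∀ᶠ v in 𝓝 v₀, ∃ γ : ℝ → M, ∃ a b : ℝ, IsGeodesicFromOn q v γ a b ∧
    T ∈ Ioo a b ∧ γ T ∈ (chartAt E x₁).source ∧ chartState (E := E) x₁ γ T = G v

variable [FiniteDimensional ℝ E] [IsManifold 𝓘(ℝ, E) ∞ M]
  [IsContMDiffRiemannianBundle 𝓘(ℝ, E) ∞ E (fun x : M ↦ TangentSpace 𝓘(ℝ, E) x)]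

lemma exists_isGeodesicFlow {x₁ : M} {z₁ : E × E} (hz : z₁.1 ∈ (chartAt E x₁).target) :
    ∃ δ W Φ A, IsGeodesicFlow (E := E) x₁ δ W Φ A ∧ z₁ ∈ W :=
  have : CompleteSpace E := FiniteDimensional.complete ℝ E
  exists_isLocalFlow ((contDiffAt_spray hz).of_le (by norm_cast))
    (((chartAt E x₁).open_target.preimage continuous_fst).mem_nhds hz)

lemma isGeodesicFamily_zero (q : M) (v₀ : E) :
    IsGeodesicFamily q v₀ q 0 (fun v ↦ (chartAt E q q, v)) := by
  obtain ⟨δ, W, Φ, A, h, hW⟩ := exists_isGeodesicFlow (z₁ := (chartAt E q q, v₀))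
    (mem_chart_target E q)
  have hsmooth : ContDiffAt ℝ 1 (fun v : E ↦ ((chartAt E q q, v) : E × E)) v₀ :=
    contDiffAt_const.prodMk contDiffAt_id
  refine ⟨hsmooth, ?_⟩
  filter_upwards [hsmooth.continuousAt.eventually_mem (h.isOpen.mem_nhds hW)] with v hv
  have hγ := h.isGeodesicFromOn_flowCurve hv
  exact ⟨_, _, _, hγ, hγ.zero_mem, hγ.solvesGeodesicEq_zero.self_of_nhds.1, hγ.chartState_zero⟩

variable [T2Space M]

lemma IsGeodesicFromOn.glue {q : M} {v : E} {γ γ' : ℝ → M} {a b a' b' T : ℝ}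
    (h : IsGeodesicFromOn q v γ a b)
    (h' : ∀ t ∈ Ioo a' b', ∃ x₀ : M, SolvesGeodesicEq (E := E) x₀ γ' t) (hT : T ∈ Ioo a b)
    (hT' : T ∈ Ioo a' b') (heq : γ =ᶠ[𝓝 T] γ') :
    ∃ γ'' : ℝ → M, IsGeodesicFromOn q v γ'' (min a a') (max b b') ∧
      ∀ t ∈ Ioo a' b', γ'' =ᶠ[𝓝 t] γ' := by
  classical
  have hagree : ∀ t ∈ Ioo a b ∩ Ioo a' b', γ t = γ' t := fun t ht ↦
    (eventuallyEq_of_solvesGeodesicEq (ordConnected_Ioo.inter ordConnected_Ioo).isPreconnected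
      (fun t ht ↦ h.solves t ht.1) (fun t ht ↦ h' t ht.2) ⟨hT, hT'⟩ heq ht).self_of_nhds
  have hleft : ∀ t ∈ Ioo a b, (Ioo a b).piecewise γ γ' =ᶠ[𝓝 t] γ := fun t ht ↦
    (piecewise_eqOn _ γ γ').eventuallyEq_of_mem (isOpen_Ioo.mem_nhds ht)
  have hright : ∀ t ∈ Ioo a' b', (Ioo a b).piecewise γ γ' =ᶠ[𝓝 t] γ' := fun t ht ↦ by
    filter_upwards [isOpen_Ioo.mem_nhds ht] with τ hτ
    by_cases hmem : τ ∈ Ioo a b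
    · exact (piecewise_eq_of_mem _ _ _ hmem).trans (hagree τ ⟨hmem, hτ⟩)
    · exact piecewise_eq_of_notMem _ _ _ hmem
  refine ⟨(Ioo a b).piecewise γ γ', ⟨?_, fun t ht ↦ ?_, ?_, ?_⟩, hright⟩
  · exact ⟨min_lt_of_left_lt h.zero_mem.1, lt_max_of_lt_left h.zero_mem.2⟩
  · rw [← Ioo_union_Ioo' (hT'.1.trans hT.2) (hT.1.trans hT'.2)] at ht
    rcases ht with ht | ht
    · obtain ⟨x₀, hx₀⟩ := h.solves t ht
      exact ⟨x₀, hx₀.congr (hleft t ht)⟩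
    · obtain ⟨x₀, hx₀⟩ := h' t ht
      exact ⟨x₀, hx₀.congr (hright t ht)⟩
  · rw [(hleft 0 h.zero_mem).self_of_nhds, h.start]
  · rw [(chartState_eventuallyEq (hleft 0 h.zero_mem) q).self_of_nhds, h.chartState_zero]

lemma IsGeodesicFamily.chartState_eq {q : M} {v₀ : E} {x₁ : M} {T : ℝ} {G : E → E × E}
    (h : IsGeodesicFamily q v₀ x₁ T G) {γ₀ : ℝ → M} {a b : ℝ}
    (h₀ : IsGeodesicFromOn q v₀ γ₀ a b) (hT : T ∈ Ioo a b) :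
    γ₀ T ∈ (chartAt E x₁).source ∧ chartState (E := E) x₁ γ₀ T = G v₀ := by
  obtain ⟨γ, a', b', hγ, hT', hmem, hstate⟩ := h.2.self_of_nhds
  have heq := h₀.eventuallyEq hγ hT hT'
  exact ⟨heq.self_of_nhds ▸ hmem, (chartState_eventuallyEq heq x₁).self_of_nhds.trans hstate⟩

lemma IsGeodesicFamily.change_chart {q : M} {v₀ : E} {x₁ x₂ : M} {T : ℝ}
    {G : E → E × E} (h : IsGeodesicFamily q v₀ x₁ T G) {γ₀ : ℝ → M} {a b : ℝ}
    (h₀ : IsGeodesicFromOn q v₀ γ₀ a b) (hT : T ∈ Ioo a b) (h₂ : γ₀ T ∈ (chartAt E x₂).source) :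
    IsGeodesicFamily q v₀ x₂ T (stateTransition x₁ x₂ ∘ G) := by
  obtain ⟨h₁, hG⟩ := h.chartState_eq h₀ hT
  have hG₀ : G v₀ = (chartAt E x₁ (γ₀ T), (G v₀).2) := Prod.ext (congrArg Prod.fst hG).symm rfl
  refine ⟨ContDiffAt.comp v₀ (hG₀ ▸ contDiffAt_stateTransition h₁ h₂) h.1, ?_⟩
  have hcont : ContinuousAt (fun v ↦ (chartAt E x₁).symm (G v).1) v₀ := by
    refine ContinuousAt.comp (f := fun v ↦ (G v).1) ((chartAt E x₁).continuousAt_symm ?_)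
      (continuousAt_fst.comp h.1.continuousAt)
    rw [hG₀]
    exact (chartAt E x₁).map_source h₁
  have hmem : ∀ᶠ v in 𝓝 v₀, (chartAt E x₁).symm (G v).1 ∈ (chartAt E x₂).source := by
    refine hcont.eventually_mem ((chartAt E x₂).open_source.mem_nhds ?_)
    rwa [hG₀, (chartAt E x₁).left_inv h₁]
  filter_upwards [h.2, hmem] with v ⟨γ, a', b', hγ, hTγ, hγ₁, hstate⟩ hγ₂
  rw [← hstate, chartState, (chartAt E x₁).left_inv hγ₁] at hγ₂
  refine ⟨γ, a', b', hγ, hTγ, hγ₂, ?_⟩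
  rw [Function.comp_apply, ← hstate]
  exact (hγ.solvesGeodesicEq hTγ hγ₁).chartState_eq hγ₂

lemma IsGeodesicFlow.isGeodesicFamily {x₁ : M} {δ : ℝ} {W : Set (E × E)}
    {Φ : E × E → ℝ → E × E} {A : E × E → ℝ → E × E →L[ℝ] E × E}
    (h : IsGeodesicFlow x₁ δ W Φ A) {q : M} {v₀ : E} {T T' : ℝ} {G : E → E × E}
    (hG : IsGeodesicFamily q v₀ x₁ T G) (hW : G v₀ ∈ W) (hT' : T' ∈ Ioo (T - δ) (T + δ)) :
    IsGeodesicFamily q v₀ x₁ T' (fun v ↦ Φ (G v) (T' - T)) := by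
  have hδ := h.pos
  have hT : T ∈ Ioo (T - δ) (T + δ) := ⟨by linarith, by linarith⟩
  refine ⟨ContDiffAt.comp v₀
    (h.contDiffAt hW ⟨by linarith [hT'.1], by linarith [hT'.2]⟩) hG.1, ?_⟩
  filter_upwards [hG.2, hG.1.continuousAt.eventually_mem (h.isOpen.mem_nhds hW)]
    with v ⟨γ, a, b, hγ, hTγ, hmem, hstate⟩ hv
  have hflow := fun t (ht : t ∈ Ioo (T - δ) (T + δ)) ↦ h.solvesGeodesicEq_flowCurve hv ht
  have heq : γ =ᶠ[𝓝 T] flowCurve x₁ Φ (G v) T := by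
    refine (hγ.solvesGeodesicEq hTγ hmem).eventuallyEq (hflow T hT).1 ?_
    rw [hstate, (hflow T hT).2, sub_self, h.zero _ hv]
  obtain ⟨γ', hγ', heq'⟩ := hγ.glue (fun t ht ↦ ⟨x₁, (hflow t ht).1⟩) hTγ hT heq
  exact ⟨γ', _, _, hγ', ⟨min_lt_of_right_lt hT'.1, lt_max_of_lt_right hT'.2⟩,
    (heq' T' hT').self_of_nhds ▸ (hflow T' hT').1.self_of_nhds.1,
    (chartState_eventuallyEq (heq' T' hT') x₁).self_of_nhds.trans (hflow T' hT').2⟩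

lemma IsGeodesicFlow.exists_isGeodesicFamily {x₁ : M} {δ : ℝ} {W : Set (E × E)}
    {Φ : E × E → ℝ → E × E} {A : E × E → ℝ → E × E →L[ℝ] E × E}
    (h : IsGeodesicFlow x₁ δ W Φ A) {q : M} {v₀ : E} {γ₀ : ℝ → M} {a b : ℝ}
    (h₀ : IsGeodesicFromOn q v₀ γ₀ a b) {T T' : ℝ} (hT : T ∈ Ioo a b)
    (hmem : γ₀ T ∈ (chartAt E x₁).source) (hW : chartState (E := E) x₁ γ₀ T ∈ W)
    (hT' : T' ∈ Ioo (T - δ) (T + δ)) :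
    (∃ x G, IsGeodesicFamily q v₀ x T G) → ∃ x G, IsGeodesicFamily q v₀ x T' G := by
  rintro ⟨x, G, hG⟩
  have hG₁ := hG.change_chart h₀ hT hmem
  exact ⟨x₁, _, h.isGeodesicFamily hG₁ ((hG₁.chartState_eq h₀ hT).2 ▸ hW) hT'⟩

lemma IsGeodesicFromOn.exists_isGeodesicFamily {q : M} {v₀ : E} {γ₀ : ℝ → M} {a b : ℝ}
    (h₀ : IsGeodesicFromOn q v₀ γ₀ a b) {T : ℝ} (hT : T ∈ Ioo a b) {x₁ : M}
    (h₁ : γ₀ T ∈ (chartAt E x₁).source) : ∃ G, IsGeodesicFamily q v₀ x₁ T G := by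
  suffices hchart : ∃ x G, IsGeodesicFamily q v₀ x T G by
    obtain ⟨x, G, hG⟩ := hchart
    exact ⟨_, hG.change_chart h₀ hT h₁⟩
  -- The times at which the family exists form a subset of `(a, b)` that is open and closed.
  refine (isPreconnected_Ioo.induction₂ (s := Ioo a b) (fun T T' ↦
    ((∃ x G, IsGeodesicFamily q v₀ x T G) ↔ ∃ x G, IsGeodesicFamily q v₀ x T' G))
    (fun T₁ hT₁ ↦ ?_) (fun _ _ _ _ _ _ h₁ h₂ ↦ h₁.trans h₂) (fun _ _ _ _ h ↦ h.symm)
    h₀.zero_mem hT).1 ⟨q, _, isGeodesicFamily_zero q v₀⟩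
  have hmem : γ₀ T₁ ∈ (chartAt E (γ₀ T₁)).source := mem_chart_source E (γ₀ T₁)
  have hsolves := h₀.solvesGeodesicEq hT₁ hmem
  obtain ⟨δ, W, Φ, A, h, hW⟩ := exists_isGeodesicFlow
    (z₁ := chartState (E := E) (γ₀ T₁) γ₀ T₁) ((chartAt E (γ₀ T₁)).map_source hmem)
  have hδ := h.pos
  filter_upwards [nhdsWithin_le_nhds hsolves, self_mem_nhdsWithin,
    nhdsWithin_le_nhds (hsolves.self_of_nhds.2.2.continuousAt.eventually_mem
      (h.isOpen.mem_nhds hW)),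
    nhdsWithin_le_nhds (Ioo_mem_nhds (sub_lt_self T₁ hδ) (lt_add_of_pos_right T₁ hδ))]
    with T' hT'mem hT' hT'W hT'δ
  exact ⟨h.exists_isGeodesicFamily h₀ hT₁ hmem hW hT'δ,
    h.exists_isGeodesicFamily h₀ hT' hT'mem.1 hT'W
      ⟨by linarith [hT'δ.2], by linarith [hT'δ.1]⟩⟩

end SmoothDependence

section ExpMap

variable {E : Type*} [NormedAddCommGroup E] [NormedSpace ℝ E] [FiniteDimensional ℝ E]
  {M : Type*} [TopologicalSpace M] [ChartedSpace E M] [IsManifold 𝓘(ℝ, E) ∞ M]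
  [RiemannianBundle (fun x : M ↦ TangentSpace 𝓘(ℝ, E) x)]

/-- The exponential map at `q`, as a function on the model space `E` of `T_q M`. -/
def modelExp (q : M) (v : E) : M := expMap (E := E) q v

/-- The differential at `v₀` of `v ↦ Exp_q (t v)`, applied to `w`: the variation field of the
geodesics with initial velocity `v₀ + s w`. -/
def variationField (q : M) (v₀ w : E) (t : ℝ) : TangentSpace 𝓘(ℝ, E) (modelExp q (t • v₀)) :=
  mfderiv 𝓘(ℝ, E) 𝓘(ℝ, E) (fun v : E ↦ modelExp q (t • v)) v₀ w

/-- In the chart at `x₁`, the coordinates of the vector field `J` along `γ` are, near time `t`, the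
first component of a solution `Y = (v, v')` of the geodesic equation linearized at `γ`. -/
def SolvesLinearizedEq (x₁ : M) (γ : ℝ → M) (J : ∀ t, TangentSpace 𝓘(ℝ, E) (γ t)) (t : ℝ) :
    Prop :=
  ∃ Y : ℝ → E × E, ∀ᶠ τ in 𝓝 t,
    HasDerivAt Y (fderiv ℝ (spray x₁) (chartState (E := E) x₁ γ τ) (Y τ)) τ ∧
    chartDeriv (E := E) x₁ (γ τ) (J τ) = (Y τ).1

variable [IsContMDiffRiemannianBundle 𝓘(ℝ, E) ∞ E (fun x : M ↦ TangentSpace 𝓘(ℝ, E) x)]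
  [T2Space M]

lemma IsGeodesicFromOn.modelExp_smul {q : M} {v₀ : E} {γ₀ : ℝ → M} {a b : ℝ}
    (h₀ : IsGeodesicFromOn q v₀ γ₀ a b) {T : ℝ} (hT : T ∈ Ioo a b) : modelExp q (T • v₀) = γ₀ T :=
  IsGeodesicFromOn.expMap_smul (v := (v₀ : TangentSpace 𝓘(ℝ, E) q)) h₀ hT

lemma IsGeodesicFromOn.eventuallyEq_modelExp {q : M} {v₀ : E} {γ₀ : ℝ → M} {a b : ℝ}
    (h₀ : IsGeodesicFromOn q v₀ γ₀ a b) {t : ℝ} (ht : t ∈ Ioo a b) :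
    (fun τ ↦ modelExp q (τ • v₀)) =ᶠ[𝓝 t] γ₀ := by
  filter_upwards [isOpen_Ioo.mem_nhds ht] with τ hτ using h₀.modelExp_smul hτ

lemma IsGeodesicFromOn.isGeodesicFromOn_modelExp {q : M} {v₀ : E} {γ₀ : ℝ → M} {a b : ℝ}
    (h₀ : IsGeodesicFromOn q v₀ γ₀ a b) :
    IsGeodesicFromOn q v₀ (fun t ↦ modelExp q (t • v₀)) a b where
  zero_mem := h₀.zero_mem
  solves t ht := (h₀.solves t ht).imp fun _ hx₀ ↦ hx₀.congr (h₀.eventuallyEq_modelExp ht)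
  start := (h₀.modelExp_smul h₀.zero_mem).trans h₀.start
  chartState_zero := (chartState_eventuallyEq (h₀.eventuallyEq_modelExp h₀.zero_mem)
    q).self_of_nhds.trans h₀.chartState_zero

lemma IsGeodesicFamily.modelExp_eq {q : M} {v₀ : E} {x₁ : M} {T : ℝ} {G : E → E × E}
    (h : IsGeodesicFamily q v₀ x₁ T G) :
    ∀ᶠ v in 𝓝 v₀, modelExp q (T • v) ∈ (chartAt E x₁).source ∧
      chartAt E x₁ (modelExp q (T • v)) = (G v).1 := by
  filter_upwards [h.2] with v ⟨γ, a, b, hγ, hT, hmem, hstate⟩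
  rw [hγ.modelExp_smul hT]
  exact ⟨hmem, congrArg Prod.fst hstate⟩

lemma IsGeodesicFromOn.contMDiffAt_modelExp {q : M} {v₀ : E} {γ₀ : ℝ → M} {a b : ℝ}
    (h₀ : IsGeodesicFromOn q v₀ γ₀ a b) {T : ℝ} (hT : T ∈ Ioo a b) :
    ContMDiffAt 𝓘(ℝ, E) 𝓘(ℝ, E) 1 (fun v ↦ modelExp q (T • v)) v₀ := by
  obtain ⟨G, hG⟩ := h₀.exists_isGeodesicFamily hT (mem_chart_source E (γ₀ T))
  have hcoord : ContDiffAt ℝ 1 (fun v ↦ (G v).1) v₀ := contDiffAt_fst.comp v₀ hG.1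
  obtain ⟨hsource, hchart⟩ := hG.modelExp_eq.self_of_nhds
  have hlift := ((contMDiffAt_chart_symm (hchart ▸ (chartAt E (γ₀ T)).map_source hsource)).of_le
    (by norm_cast)).comp v₀ hcoord.contMDiffAt
  refine hlift.congr_of_eventuallyEq (hG.modelExp_eq.mono fun v hv ↦ ?_)
  rw [Function.comp_apply, ← hv.2, (chartAt E (γ₀ T)).left_inv hv.1]

lemma IsGeodesicFromOn.chartDeriv_variationField {q : M} {v₀ : E} {γ₀ : ℝ → M} {a b : ℝ}
    (h₀ : IsGeodesicFromOn q v₀ γ₀ a b) {T : ℝ} (hT : T ∈ Ioo a b) {x₁ : M}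
    (h₁ : modelExp q (T • v₀) ∈ (chartAt E x₁).source) (w : E) :
    chartDeriv (E := E) x₁ (modelExp q (T • v₀)) (variationField q v₀ w T) =
      fderiv ℝ (fun v ↦ chartAt E x₁ (modelExp q (T • v))) v₀ w := by
  have hcomp := mfderiv_comp (I := 𝓘(ℝ, E)) (I' := 𝓘(ℝ, E)) (I'' := 𝓘(ℝ, E)) v₀
    (g := chartAt E x₁) (f := fun v : E ↦ modelExp q (T • v))
    ((mdifferentiable_chartAt x₁).mdifferentiableAt h₁)
    ((h₀.contMDiffAt_modelExp hT).mdifferentiableAt one_ne_zero)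
  rw [mfderiv_eq_fderiv] at hcomp
  exact (DFunLike.congr_fun hcomp w).symm

lemma IsGeodesicFamily.chartDeriv_variationField {q : M} {v₀ : E} {x₁ : M} {T : ℝ}
    {G : E → E × E} (h : IsGeodesicFamily q v₀ x₁ T G) {γ₀ : ℝ → M} {a b : ℝ}
    (h₀ : IsGeodesicFromOn q v₀ γ₀ a b) (hT : T ∈ Ioo a b) (w : E) :
    chartDeriv (E := E) x₁ (modelExp q (T • v₀)) (variationField q v₀ w T) =
      (fderiv ℝ G v₀ w).1 := by
  have hfst : HasFDerivAt (fun v ↦ (G v).1)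
      ((ContinuousLinearMap.fst ℝ E E).comp (fderiv ℝ G v₀)) v₀ :=
    (h.1.differentiableAt one_ne_zero).hasFDerivAt.fst
  have hcoord : (fun v ↦ chartAt E x₁ (modelExp q (T • v))) =ᶠ[𝓝 v₀] fun v ↦ (G v).1 :=
    h.modelExp_eq.mono fun _ hv ↦ hv.2
  rw [h₀.chartDeriv_variationField hT h.modelExp_eq.self_of_nhds.1, hcoord.fderiv_eq, hfst.fderiv]
  rfl

lemma IsGeodesicFromOn.solvesLinearizedEq {q : M} {v₀ : E} {γ₀ : ℝ → M} {a b : ℝ}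
    (h₀ : IsGeodesicFromOn q v₀ γ₀ a b) {T : ℝ} (hT : T ∈ Ioo a b) {x₁ : M}
    (h₁ : γ₀ T ∈ (chartAt E x₁).source) (w : E) :
    SolvesLinearizedEq (E := E) x₁ (fun t ↦ modelExp q (t • v₀)) (variationField q v₀ w) T := by
  obtain ⟨G, hG⟩ := h₀.exists_isGeodesicFamily hT h₁
  obtain ⟨δ, W, Φ, A, h, hW⟩ := exists_isGeodesicFlow
    (z₁ := chartState (E := E) x₁ γ₀ T) ((chartAt E x₁).map_source h₁)
  rw [(hG.chartState_eq h₀ hT).2] at hW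
  refine ⟨fun t ↦ A (G v₀) (t - T) (fderiv ℝ G v₀ w), ?_⟩
  filter_upwards [Ioo_mem_nhds (sub_lt_self T h.pos) (lt_add_of_pos_right T h.pos),
    isOpen_Ioo.mem_nhds hT] with t ht htab
  have hτ : t - T ∈ Ioo (-δ) δ := ⟨by linarith [ht.1], by linarith [ht.2]⟩
  have hGt := h.isGeodesicFamily hG hW ht
  have hflow : HasFDerivAt (fun v ↦ Φ (G v) (t - T)) (A (G v₀) (t - T) ∘L fderiv ℝ G v₀) v₀ :=
    HasFDerivAt.comp (f := G) v₀ (h.hasFDerivAt _ hW _ hτ)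
      (hG.1.differentiableAt one_ne_zero).hasFDerivAt
  constructor
  · rw [(hGt.chartState_eq h₀.isGeodesicFromOn_modelExp htab).2]
    simpa using ((h.hasDerivAt_deriv _ hW _ hτ).comp_sub_const t T).clm_apply
      (hasDerivAt_const t (fderiv ℝ G v₀ w))
  · rw [hGt.chartDeriv_variationField h₀ htab, hflow.fderiv]
    rfl

end ExpMap

section CoordinateCurvature

variable {E : Type*} [NormedAddCommGroup E] [NormedSpace ℝ E]

/-- The curvature `R(u, w)z` at `y` of the connection on `E` with Christoffel symbols `Γ`. -/
def curvatureForm (Γ : E → E →L[ℝ] E →L[ℝ] E) (y u w z : E) : E :=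
  fderiv ℝ Γ y u w z - fderiv ℝ Γ y w u z + Γ y u (Γ y w z) - Γ y w (Γ y u z)

/-- The Jacobi equation in coordinates: for a geodesic with state `X = (x, x')` and a solution
`Y = (v, v')` of the linearized geodesic equation, `D_t v = v' + Γ_x(x', v)` satisfies
`D_t D_t v + R(v, x')x' = 0`. -/
lemma hasDerivAt_covDeriv_linearized {Γ : E → E →L[ℝ] E →L[ℝ] E} {X Y : ℝ → E × E} {t : ℝ}
    (hΓ : DifferentiableAt ℝ Γ (X t).1)
    (hsymm : ∀ᶠ y in 𝓝 (X t).1, ∀ u w, Γ y u w = Γ y w u)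
    (hX : HasDerivAt X ((X t).2, -Γ (X t).1 (X t).2 (X t).2) t)
    (hY : HasDerivAt Y ((Y t).2, -(fderiv ℝ Γ (X t).1 (Y t).1 (X t).2 (X t).2
      + Γ (X t).1 (Y t).2 (X t).2 + Γ (X t).1 (X t).2 (Y t).2)) t) :
    HasDerivAt (fun τ ↦ (Y τ).2 + Γ (X τ).1 (X τ).2 (Y τ).1)
      (-curvatureForm Γ (X t).1 (Y t).1 (X t).2 (X t).2
        - Γ (X t).1 (X t).2 ((Y t).2 + Γ (X t).1 (X t).2 (Y t).1)) t := by
  have hx : HasDerivAt (fun τ ↦ (X τ).1) (X t).2 t :=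
    (ContinuousLinearMap.fst ℝ E E).hasFDerivAt.comp_hasDerivAt t hX
  have hx' : HasDerivAt (fun τ ↦ (X τ).2) (-Γ (X t).1 (X t).2 (X t).2) t :=
    (ContinuousLinearMap.snd ℝ E E).hasFDerivAt.comp_hasDerivAt t hX
  have hv : HasDerivAt (fun τ ↦ (Y τ).1) (Y t).2 t :=
    (ContinuousLinearMap.fst ℝ E E).hasFDerivAt.comp_hasDerivAt t hY
  have hv' : HasDerivAt (fun τ ↦ (Y τ).2) (-(fderiv ℝ Γ (X t).1 (Y t).1 (X t).2 (X t).2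
      + Γ (X t).1 (Y t).2 (X t).2 + Γ (X t).1 (X t).2 (Y t).2)) t :=
    (ContinuousLinearMap.snd ℝ E E).hasFDerivAt.comp_hasDerivAt t hY
  have hΓx : HasDerivAt (fun τ ↦ Γ (X τ).1) (fderiv ℝ Γ (X t).1 (X t).2) t :=
    HasFDerivAt.comp_hasDerivAt (f := fun τ ↦ (X τ).1) t hΓ.hasFDerivAt hx
  refine (hv'.add ((hΓx.clm_apply hx').clm_apply hv)).congr_deriv ?_
  have hsymm₀ := hsymm.self_of_nhds
  rw [curvatureForm, hsymm₀ (Y t).1 (Γ (X t).1 (X t).2 (X t).2), hsymm₀ (Y t).1 (X t).2,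
    hsymm₀ (Y t).2 (X t).2, fderiv_symm_of_eventually hΓ hsymm (X t).2 (Y t).1]
  simp only [add_apply, map_add, map_neg, neg_apply]
  abel

end CoordinateCurvature

section Jacobi

variable {E : Type*} [NormedAddCommGroup E] [NormedSpace ℝ E]
  {M : Type*} [TopologicalSpace M] [ChartedSpace E M] [IsManifold 𝓘(ℝ, E) ∞ M]

lemma trivializationAt_snd {x₁ m : M} (hm : m ∈ (chartAt E x₁).source)
    (v : TangentSpace 𝓘(ℝ, E) m) :
    (trivializationAt E (TangentSpace 𝓘(ℝ, E)) x₁ (⟨m, v⟩ : TangentBundle 𝓘(ℝ, E) M)).2 =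
      chartDeriv (E := E) x₁ m v := by
  have : IsManifold 𝓘(ℝ, E) 1 M := .of_le (n := ∞) (by simp)
  rw [chartDeriv, mfderiv_chartAt_eq_tangentCoordChange hm]
  rfl

variable [FiniteDimensional ℝ E] [RiemannianBundle (fun x : M ↦ TangentSpace 𝓘(ℝ, E) x)]
  [IsContMDiffRiemannianBundle 𝓘(ℝ, E) ∞ E (fun x : M ↦ TangentSpace 𝓘(ℝ, E) x)]

lemma curvature_eq_curvatureForm (x : M) (u w z : E) :
    (curvature (E := E) x u w z : E) =
      curvatureForm (christoffelForm (metricInChart x)) (chartAt E x x) u w z := by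
  have hΓ (u w : E) := (hasFDerivAt_apply_apply ((contDiffAt_christoffelForm_metricInChart
    (mem_chart_target E x)).differentiableAt (by simp)) u w).fderiv
  have hcurv : (curvature (E := E) x u w z : E) =
      fderiv ℝ (fun y ↦ christoffelForm (metricInChart x) y w z) (chartAt E x x) u
      - fderiv ℝ (fun y ↦ christoffelForm (metricInChart x) y u z) (chartAt E x x) w
      + christoffelForm (metricInChart x) (chartAt E x x) u
          (christoffelForm (metricInChart x) (chartAt E x x) w z)
      - christoffelForm (metricInChart x) (chartAt E x x) w
          (christoffelForm (metricInChart x) (chartAt E x x) u z) := rfl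
  rw [hcurv, hΓ, hΓ]
  rfl

lemma SolvesGeodesicEq.chartDeriv_covDerivAlong_eventuallyEq {x₁ : M} {γ : ℝ → M} {t : ℝ}
    (hγ : SolvesGeodesicEq (E := E) x₁ γ t) {J : ∀ t, TangentSpace 𝓘(ℝ, E) (γ t)} {Y : ℝ → E × E}
    (hY : ∀ᶠ τ in 𝓝 t,
      HasDerivAt Y (fderiv ℝ (spray x₁) (chartState (E := E) x₁ γ τ) (Y τ)) τ ∧
      chartDeriv (E := E) x₁ (γ τ) (J τ) = (Y τ).1) :
    (fun τ ↦ chartDeriv (E := E) x₁ (γ τ) (covDerivAlong γ J τ)) =ᶠ[𝓝 t] fun τ ↦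
      (Y τ).2 + christoffelForm (metricInChart x₁) (chartState (E := E) x₁ γ τ).1
        (chartState (E := E) x₁ γ τ).2 (Y τ).1 := by
  filter_upwards [hγ, hY.eventually_nhds] with τ ⟨hmem, hcont, hstate⟩ hYτ
  obtain ⟨hlin, hcoord⟩ := hYτ.self_of_nhds
  rw [fderiv_spray ((chartAt E x₁).map_source hmem)] at hlin
  have hJ : HasDerivAt (fun σ ↦ chartDeriv (E := E) x₁ (γ σ) (J σ)) (Y τ).2 τ :=
    ((ContinuousLinearMap.fst ℝ E E).hasFDerivAt.comp_hasDerivAt τ hlin).congr_of_eventuallyEq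
      (hYτ.mono fun σ hσ ↦ hσ.2)
  have hcov := chartDeriv_covDerivAlong hmem hcont (hasDerivAt_chart_of_chartState hstate) hJ
  rwa [hcoord] at hcov

lemma SolvesGeodesicEq.chartDeriv_covDerivAlong_covDerivAlong {x₁ : M} {γ : ℝ → M} {t : ℝ}
    (hγ : SolvesGeodesicEq (E := E) x₁ γ t) {J : ∀ t, TangentSpace 𝓘(ℝ, E) (γ t)} {Y : ℝ → E × E}
    (hY : ∀ᶠ τ in 𝓝 t,
      HasDerivAt Y (fderiv ℝ (spray x₁) (chartState (E := E) x₁ γ τ) (Y τ)) τ ∧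
      chartDeriv (E := E) x₁ (γ τ) (J τ) = (Y τ).1) :
    chartDeriv (E := E) x₁ (γ t) (covDerivAlong γ (covDerivAlong γ J) t) =
      -curvatureForm (christoffelForm (metricInChart x₁)) (chartState (E := E) x₁ γ t).1 (Y t).1
        (chartState (E := E) x₁ γ t).2 (chartState (E := E) x₁ γ t).2 := by
  have hDt := hγ.chartDeriv_covDerivAlong_eventuallyEq hY
  obtain ⟨hmem, hcont, hstate⟩ := hγ.self_of_nhds
  have hy : chartAt E x₁ (γ t) ∈ (chartAt E x₁).target := (chartAt E x₁).map_source hmem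
  have hlin := hY.self_of_nhds.1
  rw [fderiv_spray hy] at hlin
  have hsymm := ((chartAt E x₁).open_target.eventually_mem hy).mono
    fun y' hy' ↦ christoffel_symm (E := E) hy'
  have hderiv := hasDerivAt_covDeriv_linearized
    ((contDiffAt_christoffelForm_metricInChart hy).differentiableAt (by simp)) hsymm hstate hlin
  have hDDt := chartDeriv_covDerivAlong hmem hcont (hasDerivAt_chart_of_chartState hstate)
    (hderiv.congr_of_eventuallyEq hDt)
  have hDt₀ : chartDeriv (E := E) x₁ (γ t) (covDerivAlong γ J t) = _ := hDt.self_of_nhds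
  rw [hDt₀] at hDDt
  exact hDDt.trans (sub_add_cancel _ _)

lemma SolvesLinearizedEq.jacobi_equation {γ : ℝ → M} {J : ∀ t, TangentSpace 𝓘(ℝ, E) (γ t)} {t : ℝ}
    (hJ : SolvesLinearizedEq (γ t) γ J t) (hγ : SolvesGeodesicEq (E := E) (γ t) γ t) :
    covDerivAlong γ (covDerivAlong γ J) t
      + curvature (γ t) (J t) (velocity γ t) (velocity γ t) = 0 := by
  obtain ⟨Y, hY⟩ := hJ
  have hself (v : E) : (chartDeriv (E := E) (γ t) (γ t) v : E) = v := by rw [chartDeriv_self]; rfl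
  have hJt : (J t : E) = (Y t).1 := (hself (J t)).symm.trans hY.self_of_nhds.2
  have hvelocity : (velocity γ t : E) = (chartState (E := E) (γ t) γ t).2 :=
    (hself (velocity γ t)).symm.trans (chartDeriv_velocity (E := E) hγ.self_of_nhds.1
      (hγ.contMDiffAt.mdifferentiableAt (by norm_num)))
  have hcurv : (curvature (γ t) (J t) (velocity γ t) (velocity γ t) : E) =
      curvatureForm (christoffelForm (metricInChart (γ t))) (chartState (E := E) (γ t) γ t).1
        (Y t).1 (chartState (E := E) (γ t) γ t).2 (chartState (E := E) (γ t) γ t).2 := by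
    rw [← hJt, ← hvelocity]
    exact curvature_eq_curvatureForm (E := E) (γ t) (J t) (velocity γ t) (velocity γ t)
  have hDDt := (hself (covDerivAlong γ (covDerivAlong γ J) t)).symm.trans
    (hγ.chartDeriv_covDerivAlong_covDerivAlong hY)
  exact (congrArg₂ (fun u w : E ↦ u + w) hDDt hcurv).trans (neg_add_cancel _)

end Jacobi

section JacobiRegularity

variable {E : Type*} [NormedAddCommGroup E] [NormedSpace ℝ E] [FiniteDimensional ℝ E]
  {M : Type*} [TopologicalSpace M] [ChartedSpace E M] [IsManifold 𝓘(ℝ, E) ∞ M]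
  [RiemannianBundle (fun x : M ↦ TangentSpace 𝓘(ℝ, E) x)]
  [IsContMDiffRiemannianBundle 𝓘(ℝ, E) ∞ E (fun x : M ↦ TangentSpace 𝓘(ℝ, E) x)]

lemma SolvesGeodesicEq.contDiffAt_linearized {x₁ : M} {γ : ℝ → M} {Y : ℝ → E × E} {t : ℝ}
    (hγ : SolvesGeodesicEq (E := E) x₁ γ t)
    (hY : ∀ᶠ τ in 𝓝 t, HasDerivAt Y (fderiv ℝ (spray x₁) (chartState (E := E) x₁ γ τ) (Y τ)) τ) :
    ContDiffAt ℝ 2 (fun τ ↦ (Y τ).1) t := by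
  have hspray : ContDiffAt ℝ 0 (fderiv ℝ (spray (E := E) x₁)) (chartState (E := E) x₁ γ t) :=
    (contDiffAt_spray ((chartAt E x₁).map_source hγ.self_of_nhds.1)).fderiv_right (by simp)
  have hY₁ : ContDiffAt ℝ 1 Y t := contDiffAt_succ_of_hasDerivAt hY
    ((hspray.comp t (hγ.contDiffAt_chartState.of_le zero_le_one)).clm_apply
      (contDiffAt_zero_of_hasDerivAt hY))
  refine contDiffAt_succ_of_hasDerivAt (Y' := fun τ ↦ (Y τ).2) ?_ hY₁.snd
  filter_upwards [hγ, hY] with τ hγτ hYτ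
  rw [fderiv_spray ((chartAt E x₁).map_source hγτ.1)] at hYτ
  exact (ContinuousLinearMap.fst ℝ E E).hasFDerivAt.comp_hasDerivAt τ hYτ

lemma SolvesLinearizedEq.contMDiffAt {γ : ℝ → M} {J : ∀ t, TangentSpace 𝓘(ℝ, E) (γ t)} {t : ℝ}
    (hJ : SolvesLinearizedEq (γ t) γ J t) (hγ : SolvesGeodesicEq (E := E) (γ t) γ t) :
    ContMDiffAt 𝓘(ℝ, ℝ) 𝓘(ℝ, E).tangent 2
      (fun t ↦ (⟨γ t, J t⟩ : TangentBundle 𝓘(ℝ, E) M)) t := by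
  have : IsManifold 𝓘(ℝ, E) 1 M := .of_le (n := ∞) (by simp)
  obtain ⟨Y, hY⟩ := hJ
  refine (Bundle.contMDiffAt_totalSpace.2 ⟨hγ.contMDiffAt, ?_⟩)
  rw [contMDiffAt_iff_contDiffAt]
  refine (hγ.contDiffAt_linearized (hY.mono fun _ h ↦ h.1)).congr_of_eventuallyEq ?_
  filter_upwards [hγ, hY] with τ hγτ hYτ
  exact (trivializationAt_snd hγτ.1 _).trans hYτ.2

lemma IsGeodesicFromOn.isJacobiFieldOn_variationField [T2Space M] {q : M} {v₀ : E} {γ₀ : ℝ → M}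
    {a b : ℝ} (h₀ : IsGeodesicFromOn q v₀ γ₀ a b) (w : E) :
    IsJacobiFieldOn (fun t ↦ modelExp q (t • v₀)) (variationField q v₀ w) (Ioo a b) := by
  set γ : ℝ → M := fun t ↦ modelExp q (t • v₀)
  have hray : IsGeodesicFromOn q v₀ γ a b := h₀.isGeodesicFromOn_modelExp
  have hγ (t : ℝ) (ht : t ∈ Ioo a b) : SolvesGeodesicEq (E := E) (γ t) γ t :=
    hray.solvesGeodesicEq ht (mem_chart_source E (γ t))
  have hJ (t : ℝ) (ht : t ∈ Ioo a b) : SolvesLinearizedEq (γ t) γ (variationField q v₀ w) t :=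
    hray.solvesLinearizedEq ht (mem_chart_source E (γ t)) w
  exact ⟨fun t ht ↦ ((hJ t ht).contMDiffAt (hγ t ht)).contMDiffWithinAt,
    fun t ht ↦ (hJ t ht).jacobi_equation (hγ t ht)⟩

end JacobiRegularity

section LogMap

lemma exists_hasFDerivAt_localInverse {E : Type*} [NormedAddCommGroup E] [NormedSpace ℝ E]
    [FiniteDimensional ℝ E] {F : E → E} {v₀ : E} (hF : ContDiffAt ℝ 1 F v₀)
    (hinj : Function.Injective (fderiv ℝ F v₀)) :
    ∃ (F' : E ≃L[ℝ] E) (g : E → E), (F' : E →L[ℝ] E) = fderiv ℝ F v₀ ∧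
      HasFDerivAt g (F'.symm : E →L[ℝ] E) (F v₀) ∧ g (F v₀) = v₀ ∧
      ∀ᶠ y in 𝓝 (F v₀), F (g y) = y := by
  have : CompleteSpace E := FiniteDimensional.complete ℝ E
  let F' : E ≃L[ℝ] E :=
    (LinearEquiv.ofInjectiveEndo (fderiv ℝ F v₀ : E →ₗ[ℝ] E) hinj).toContinuousLinearEquiv
  have hF' : (F' : E →L[ℝ] E) = fderiv ℝ F v₀ := rfl
  have hstrict : HasStrictFDerivAt F (F' : E →L[ℝ] E) v₀ :=
    hF' ▸ hF.hasStrictFDerivAt one_ne_zero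
  exact ⟨F', hstrict.localInverse F F' v₀, hF', hstrict.to_localInverse.hasFDerivAt,
    hstrict.localInverse_apply_image, hstrict.eventually_right_inverse⟩

variable {E : Type*} [NormedAddCommGroup E] [NormedSpace ℝ E] {M : Type*} [TopologicalSpace M]
  [ChartedSpace E M] [RiemannianBundle (fun x : M ↦ TangentSpace 𝓘(ℝ, E) x)]

/-- The domain of `Exp_q`, as a subset of the model space `E` of `T_q M`. -/
def modelExpDomain (q : M) : Set E := expDomain (E := E) q

/-- The logarithm at `q`, with values in the model space `E` of `T_q M`. -/
def modelLog (q : M) (D : Set E) : M → E := logMap (E := E) q D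

lemma modelLog_mem {p q : M} {D : Set E} (hpD : p ∈ modelExp q '' D) : modelLog q D p ∈ D :=
  Function.invFunOn_mem hpD

lemma modelExp_modelLog {p q : M} {D : Set E} (hpD : p ∈ modelExp q '' D) :
    modelExp q (modelLog q D p) = p :=
  Function.invFunOn_eq hpD

lemma modelLog_modelExp {q : M} {D : Set E} (hinj : InjOn (modelExp q) D) {v : E} (hv : v ∈ D) :
    modelLog q D (modelExp q v) = v :=
  hinj.leftInvOn_invFunOn hv

lemma variationField_zero (q : M) (v₀ w : E) : variationField q v₀ w 0 = 0 := by
  have hconst : (fun v : E ↦ modelExp q ((0 : ℝ) • v)) = fun _ ↦ modelExp (E := E) q 0 := by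
    simp only [zero_smul]
  have hderiv : mfderiv 𝓘(ℝ, E) 𝓘(ℝ, E) (fun v : E ↦ modelExp q ((0 : ℝ) • v)) v₀ = 0 := by
    rw [hconst]
    exact mfderiv_const
  exact DFunLike.congr_fun hderiv w

variable [FiniteDimensional ℝ E] [IsManifold 𝓘(ℝ, E) ∞ M]
  [IsContMDiffRiemannianBundle 𝓘(ℝ, E) ∞ E (fun x : M ↦ TangentSpace 𝓘(ℝ, E) x)]

lemma exists_isGeodesicFromOn {q : M} {v : E} (hv : v ∈ modelExpDomain q) :
    ∃ γ : ℝ → M, ∃ ε > 0, IsGeodesicFromOn q v γ (0 - ε) (1 + ε) :=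
  hv.imp fun _ hγ ↦ isGeodesicFrom_iff.1 hγ

lemma zero_mem_modelExpDomain (q : M) : (0 : E) ∈ modelExpDomain q := by
  obtain ⟨γ, a, b, h, h0, -⟩ := (isGeodesicFamily_zero q (0 : E)).2.self_of_nhds
  have hdom := IsGeodesicFromOn.smul_mem_expDomain (v := (0 : TangentSpace 𝓘(ℝ, E) q)) h h0
  rwa [zero_smul] at hdom

variable [T2Space M]

lemma contMDiffAt_modelExp {q : M} {v : E} (hv : v ∈ modelExpDomain q) :
    ContMDiffAt 𝓘(ℝ, E) 𝓘(ℝ, E) 1 (modelExp (E := E) q) v := by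
  obtain ⟨γ, ε, hε, h⟩ := exists_isGeodesicFromOn hv
  simpa only [one_smul] using h.contMDiffAt_modelExp (T := 1) ⟨by linarith, by linarith⟩

lemma contDiffAt_chart_modelExp {q : M} {v : E} (hv : v ∈ modelExpDomain q) {x₁ : M}
    (h₁ : modelExp q v ∈ (chartAt E x₁).source) :
    ContDiffAt ℝ 1 (fun v ↦ chartAt E x₁ (modelExp q v)) v := by
  rw [← contMDiffAt_iff_contDiffAt]
  exact ((contMDiffAt_chart h₁).of_le (by norm_cast)).comp v (contMDiffAt_modelExp hv)

lemma modelExp_zero (q : M) : modelExp q (0 : E) = q := by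
  obtain ⟨γ, a, b, h, h0, -⟩ := (isGeodesicFamily_zero q (0 : E)).2.self_of_nhds
  have hexp := h.modelExp_smul h0
  rwa [zero_smul, h.start] at hexp

lemma contDiffAt_chart_modelExp_zero (q : M) :
    ContDiffAt ℝ 1 (fun v : E ↦ chartAt E q (modelExp q v)) 0 :=
  contDiffAt_chart_modelExp (zero_mem_modelExpDomain q)
    ((modelExp_zero (E := E) q).symm ▸ mem_chart_source E q)

lemma fderiv_chart_modelExp_zero (q : M) (v : E) :
    fderiv ℝ (fun v ↦ chartAt E q (modelExp q v)) (0 : E) v = v := by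
  obtain ⟨γ, a, b, h, h0, -⟩ := (isGeodesicFamily_zero q v).2.self_of_nhds
  have hray : HasDerivAt (fun t : ℝ ↦ t • v) v 0 := by
    simpa using (hasDerivAt_id (0 : ℝ)).smul_const v
  have hexp : HasFDerivAt (fun v ↦ chartAt E q (modelExp q v))
      (fderiv ℝ (fun v ↦ chartAt E q (modelExp q v)) (0 : E)) ((0 : ℝ) • v) := by
    rw [zero_smul]
    exact ((contDiffAt_chart_modelExp_zero q).differentiableAt one_ne_zero).hasFDerivAt
  have hcomp := (hexp.comp_hasDerivAt (0 : ℝ) hray).deriv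
  have hγ : (fun v ↦ chartAt E q (modelExp q v)) ∘ (fun t : ℝ ↦ t • v) =ᶠ[𝓝 0]
      chartAt E q ∘ γ :=
    (h.eventuallyEq_modelExp h0).fun_comp (chartAt E q)
  rw [hγ.deriv_eq] at hcomp
  exact hcomp.symm.trans (congrArg Prod.snd h.chartState_zero)

lemma IsGeodesicFromOn.chartDeriv_variationField_eq_smul {q : M} {v₀ : E} {γ₀ : ℝ → M} {a b : ℝ}
    (h₀ : IsGeodesicFromOn q v₀ γ₀ a b) {T : ℝ} (hT : T ∈ Ioo a b) {x₁ : M}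
    (h₁ : modelExp q (T • v₀) ∈ (chartAt E x₁).source) (w : E) :
    chartDeriv (E := E) x₁ (modelExp q (T • v₀)) (variationField q v₀ w T) =
      T • fderiv ℝ (fun v ↦ chartAt E x₁ (modelExp q v)) (T • v₀) w := by
  rw [h₀.chartDeriv_variationField hT h₁ w,
    fderiv_comp_smul (f := fun v ↦ chartAt E x₁ (modelExp q v))]
  rfl

lemma exists_variationField_ne_zero {q : M} {v₀ w : E} (hv : v₀ ∈ modelExpDomain q)
    (hw : w ≠ 0) : ∃ t ∈ Icc (0 : ℝ) 1, variationField q v₀ w t ≠ 0 := by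
  obtain ⟨γ, ε, hε, h⟩ := exists_isGeodesicFromOn hv
  have hderiv : ∀ᶠ v in 𝓝 (0 : E),
      fderiv ℝ (fun v ↦ chartAt E q (modelExp q v)) v w ≠ 0 := by
    have hcont := ((contDiffAt_chart_modelExp_zero (E := E) q).fderiv_right (m := 0)
      (by norm_num)).continuousAt.clm_apply (continuousAt_const (y := w))
    exact hcont.eventually_ne (by rwa [fderiv_chart_modelExp_zero])
  have hsource : ∀ᶠ v in 𝓝 (0 : E), modelExp q v ∈ (chartAt E q).source :=
    (contMDiffAt_modelExp (zero_mem_modelExpDomain q)).continuousAt.eventually_mem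
      ((chartAt E q).open_source.mem_nhds ((modelExp_zero (E := E) q).symm ▸ mem_chart_source E q))
  have hray : Tendsto (fun t : ℝ ↦ t • v₀) (𝓝[>] 0) (𝓝 0) := by
    have hcont : Continuous fun t : ℝ ↦ t • v₀ := by fun_prop
    simpa using (hcont.tendsto 0).mono_left nhdsWithin_le_nhds
  obtain ⟨t, ⟨hne, hmem⟩, ht⟩ := ((hray.eventually (hderiv.and hsource)).and
    (Ioo_mem_nhdsGT zero_lt_one)).exists
  refine ⟨t, ⟨ht.1.le, ht.2.le⟩, fun hJ ↦ smul_ne_zero ht.1.ne' hne ?_⟩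
  rw [← h.chartDeriv_variationField_eq_smul ⟨by linarith [ht.1], by linarith [ht.2]⟩ hmem, hJ]
  exact map_zero (chartDeriv (E := E) q (modelExp q (t • v₀)))

lemma injective_fderiv_chart_modelExp {q : M} {v₀ : E} (hv : v₀ ∈ modelExpDomain q) {x₁ : M}
    (h₁ : modelExp q v₀ ∈ (chartAt E x₁).source)
    (hconj : ¬ AreConjugateAlong E (fun t : ℝ ↦ modelExp q (t • v₀)) 0 1) :
    Function.Injective (fderiv ℝ (fun v ↦ chartAt E x₁ (modelExp q v)) v₀) := by
  rw [injective_iff_map_eq_zero]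
  intro w hw
  by_contra hne
  obtain ⟨γ, ε, hε, h⟩ := exists_isGeodesicFromOn hv
  have h₁' : modelExp q ((1 : ℝ) • v₀) ∈ (chartAt E x₁).source := by rwa [one_smul]
  have hcoord := h.chartDeriv_variationField_eq_smul ⟨by linarith, by linarith⟩ h₁' w
  have hcritical : fderiv ℝ (fun v ↦ chartAt E x₁ (modelExp q v)) ((1 : ℝ) • v₀) w = 0 := by
    rwa [one_smul]
  rw [hcritical, smul_zero] at hcoord
  have hend : variationField q v₀ w 1 = 0 := (isInvertible_chartDeriv h₁').injective
    (hcoord.trans (map_zero _).symm)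
  exact hconj ⟨variationField q v₀ w, ε, hε, h.isJacobiFieldOn_variationField w,
    variationField_zero q v₀ w, hend, exists_variationField_ne_zero hv hne⟩

lemma modelLog_eventuallyEq {p q : M} {D : Set E} (hD : IsOpen D) (hDdom : D ⊆ modelExpDomain q)
    (hDinj : InjOn (modelExp q) D) (hpD : p ∈ modelExp q '' D) {g : E → E}
    (hg : ContinuousAt g (chartAt E p p)) (hgp : g (chartAt E p p) = modelLog q D p)
    (hinv : ∀ᶠ y in 𝓝 (chartAt E p p), chartAt E p (modelExp q (g y)) = y) :
    modelLog q D =ᶠ[𝓝 p] g ∘ chartAt E p := by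
  have hmem : modelLog q D p ∈ D := modelLog_mem hpD
  have hgD : ∀ᶠ y in 𝓝 (chartAt E p p), g y ∈ D :=
    hg.eventually_mem (hD.mem_nhds (hgp ▸ hmem))
  have hexp : ContinuousAt (modelExp q) (g (chartAt E p p)) :=
    hgp ▸ (contMDiffAt_modelExp (hDdom hmem)).continuousAt
  have hsource : ∀ᶠ y in 𝓝 (chartAt E p p), modelExp q (g y) ∈ (chartAt E p).source :=
    (hexp.comp hg).eventually_mem ((chartAt E p).open_source.mem_nhds
      (by rw [Function.comp_apply, hgp, modelExp_modelLog hpD]; exact mem_chart_source E p))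
  filter_upwards [((chartAt E p).continuousAt (mem_chart_source E p)).eventually
    (hinv.and (hgD.and hsource)), (chartAt E p).open_source.mem_nhds (mem_chart_source E p)]
    with m ⟨hinv_m, hD_m, hsource_m⟩ hm
  have hlift : modelExp q (g (chartAt E p m)) = m := (chartAt E p).injOn hsource_m hm hinv_m
  exact (congrArg (modelLog q D) hlift).symm.trans (modelLog_modelExp hDinj hD_m)

lemma hasMFDerivAt_modelLog {p q : M} {D : Set E} (hD : IsOpen D)
    (hDdom : D ⊆ modelExpDomain q) (hDinj : InjOn (modelExp q) D) (hpD : p ∈ modelExp q '' D)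
    (hconj : ¬ AreConjugateAlong E (fun t : ℝ ↦ modelExp q (t • modelLog q D p)) 0 1) :
    ∃ L : E ≃L[ℝ] E,
      (L : E →L[ℝ] E) = fderiv ℝ (fun v ↦ chartAt E p (modelExp q v)) (modelLog q D p) ∧
      HasMFDerivAt 𝓘(ℝ, E) 𝓘(ℝ, E) (modelLog q D) p (L.symm : E →L[ℝ] E) := by
  have hdom : modelLog q D p ∈ modelExpDomain q := hDdom (modelLog_mem hpD)
  have hsource : modelExp q (modelLog q D p) ∈ (chartAt E p).source :=
    (modelExp_modelLog hpD).symm ▸ mem_chart_source E p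
  obtain ⟨L, g, hL, hg, hgp, hinv⟩ := exists_hasFDerivAt_localInverse
    (contDiffAt_chart_modelExp hdom hsource) (injective_fderiv_chart_modelExp hdom hsource hconj)
  rw [modelExp_modelLog hpD] at hg hgp hinv
  have hchart : HasMFDerivAt 𝓘(ℝ, E) 𝓘(ℝ, E) (chartAt E p) p (.id ℝ E) := by
    rw [← chartDeriv_self (E := E) p]
    exact ((mdifferentiable_chartAt p).mdifferentiableAt (mem_chart_source E p)).hasMFDerivAt
  exact ⟨L, hL, (hg.hasMFDerivAt.comp p hchart).congr_of_eventuallyEq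
    (modelLog_eventuallyEq hD hDdom hDinj hpD hg.continuousAt hgp hinv)⟩

end LogMap

section Interpolation

lemma hasDerivAt_hermiteA0 (t₀ t₁ t : ℝ) : HasDerivAt (hermiteA0 t₀ t₁)
    (-(1 / (t₁ - t₀) ^ 2 * (2 * (t - t₀)))
      + 2 / (t₁ - t₀) ^ 3 * (2 * (t - t₀) * (t - t₁) + (t - t₀) ^ 2)) t := by
  have h₀ : HasDerivAt (fun t ↦ t - t₀) 1 t := (hasDerivAt_id t).sub_const t₀
  have h₁ : HasDerivAt (fun t ↦ t - t₁) 1 t := (hasDerivAt_id t).sub_const t₁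
  refine (((h₀.pow 2).const_mul (1 / (t₁ - t₀) ^ 2)).const_sub 1 |>.add
    (((h₀.pow 2).mul h₁).const_mul (2 / (t₁ - t₀) ^ 3))).congr_deriv ?_
  simp

lemma hasDerivAt_hermiteB0 (t₀ t₁ t : ℝ) : HasDerivAt (hermiteB0 t₀ t₁)
    (1 - 1 / (t₁ - t₀) * (2 * (t - t₀))
      + 1 / (t₁ - t₀) ^ 2 * (2 * (t - t₀) * (t - t₁) + (t - t₀) ^ 2)) t := by
  have h₀ : HasDerivAt (fun t ↦ t - t₀) 1 t := (hasDerivAt_id t).sub_const t₀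
  have h₁ : HasDerivAt (fun t ↦ t - t₁) 1 t := (hasDerivAt_id t).sub_const t₁
  refine ((h₀.sub ((h₀.pow 2).const_mul (1 / (t₁ - t₀)))).add
    (((h₀.pow 2).mul h₁).const_mul (1 / (t₁ - t₀) ^ 2))).congr_deriv ?_
  simp

lemma hasDerivAt_hermiteB1 (t₀ t₁ t : ℝ) : HasDerivAt (hermiteB1 t₀ t₁)
    (1 / (t₁ - t₀) ^ 2 * (2 * (t - t₀) * (t - t₁) + (t - t₀) ^ 2)) t := by
  have h₀ : HasDerivAt (fun t ↦ t - t₀) 1 t := (hasDerivAt_id t).sub_const t₀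
  have h₁ : HasDerivAt (fun t ↦ t - t₁) 1 t := (hasDerivAt_id t).sub_const t₁
  refine (((h₀.pow 2).mul h₁).const_mul (1 / (t₁ - t₀) ^ 2)).congr_deriv ?_
  simp

variable {E : Type*} [NormedAddCommGroup E] [NormedSpace ℝ E]

/-- The cubic Hermite interpolant with value `Δ` and slope `v` at `t₀`, and with value `0` and
slope `w` at `t₁`. -/
def hermiteInterpolant (t₀ t₁ : ℝ) (Δ v w : E) (t : ℝ) : E :=
  hermiteA0 t₀ t₁ t • Δ + hermiteB0 t₀ t₁ t • v + hermiteB1 t₀ t₁ t • w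

lemma contDiff_hermiteInterpolant (t₀ t₁ : ℝ) (Δ v w : E) {n : ℕ∞ω} :
    ContDiff ℝ n (hermiteInterpolant t₀ t₁ Δ v w) := by
  unfold hermiteInterpolant hermiteA0 hermiteB0 hermiteB1
  fun_prop

lemma hasDerivAt_hermiteInterpolant_left (t₀ t₁ : ℝ) (Δ v w : E) :
    HasDerivAt (hermiteInterpolant t₀ t₁ Δ v w) v t₀ := by
  refine ((((hasDerivAt_hermiteA0 t₀ t₁ t₀).smul_const Δ).add
    ((hasDerivAt_hermiteB0 t₀ t₁ t₀).smul_const v)).add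
    ((hasDerivAt_hermiteB1 t₀ t₁ t₀).smul_const w)).congr_deriv ?_
  simp

lemma hasDerivAt_hermiteInterpolant_right {t₀ t₁ : ℝ} (ht : t₀ ≠ t₁) (Δ v w : E) :
    HasDerivAt (hermiteInterpolant t₀ t₁ Δ v w) w t₁ := by
  have hne : t₁ - t₀ ≠ 0 := sub_ne_zero.2 ht.symm
  refine ((((hasDerivAt_hermiteA0 t₀ t₁ t₁).smul_const Δ).add
    ((hasDerivAt_hermiteB0 t₀ t₁ t₁).smul_const v)).add
    ((hasDerivAt_hermiteB1 t₀ t₁ t₁).smul_const w)).congr_deriv ?_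
  rw [sub_self t₁]
  match_scalars <;> field_simp <;> ring

lemma hermiteInterpolant_left (t₀ t₁ : ℝ) (Δ v w : E) :
    hermiteInterpolant t₀ t₁ Δ v w t₀ = Δ := by
  simp [hermiteInterpolant, hermiteA0, hermiteB0, hermiteB1]

lemma hermiteInterpolant_right {t₀ t₁ : ℝ} (ht : t₀ ≠ t₁) (Δ v w : E) :
    hermiteInterpolant t₀ t₁ Δ v w t₁ = 0 := by
  have hne : t₁ - t₀ ≠ 0 := sub_ne_zero.2 ht.symm
  rw [hermiteInterpolant, hermiteA0, hermiteB0, hermiteB1, sub_self t₁]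
  match_scalars <;> field_simp <;> ring

variable [FiniteDimensional ℝ E]
  {M : Type*} [TopologicalSpace M] [T2Space M] [ChartedSpace E M] [IsManifold 𝓘(ℝ, E) ∞ M]
  [RiemannianBundle (fun x : M ↦ TangentSpace 𝓘(ℝ, E) x)]
  [IsContMDiffRiemannianBundle 𝓘(ℝ, E) ∞ E (fun x : M ↦ TangentSpace 𝓘(ℝ, E) x)]

lemma velocityWithin_modelExp_comp {q m : M} {P : ℝ → E} {t : ℝ} {P' : E} {s : Set ℝ}
    (hs : UniqueDiffWithinAt ℝ s t) (hP : HasDerivAt P P' t) (hdom : P t ∈ modelExpDomain q)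
    (hm : modelExp q (P t) = m) {u : TangentSpace 𝓘(ℝ, E) m}
    (hu : fderiv ℝ (fun v ↦ chartAt E m (modelExp q v)) (P t) P' = u) :
    velocityWithin (fun τ ↦ modelExp q (P τ)) s t = (⟨m, u⟩ : TangentBundle 𝓘(ℝ, E) M) := by
  have hexp : MDifferentiableAt 𝓘(ℝ, ℝ) 𝓘(ℝ, E) (fun τ ↦ modelExp q (P τ)) t :=
    ((contMDiffAt_modelExp hdom).mdifferentiableAt one_ne_zero).comp t
      hP.differentiableAt.mdifferentiableAt
  have hsource : modelExp q (P t) ∈ (chartAt E m).source := hm ▸ mem_chart_source E m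
  have hcoord := ((contDiffAt_chart_modelExp hdom hsource).differentiableAt
    one_ne_zero).hasFDerivAt.comp_hasDerivAt t hP
  rw [velocityWithin, mfderivWithin_eq_mfderiv hs.uniqueMDiffWithinAt hexp]
  exact (mk_velocity_eq_iff hexp).2
    ⟨hm, Prod.ext (congrArg (chartAt E m) hm) (hcoord.deriv.trans hu)⟩

end Interpolation

end RiemannHermite

end

open RiemannHermite in
theorem theorem2p1
    {E : Type*} [NormedAddCommGroup E] [NormedSpace ℝ E] [FiniteDimensional ℝ E]
    {M : Type*} [TopologicalSpace M] [T2Space M] [ChartedSpace E M] [IsManifold 𝓘(ℝ, E) ∞ M]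
    [RiemannianBundle (fun x : M ↦ TangentSpace 𝓘(ℝ, E) x)]
    [IsContMDiffRiemannianBundle 𝓘(ℝ, E) ∞ E (fun x : M ↦ TangentSpace 𝓘(ℝ, E) x)]
    (t₀ t₁ : ℝ) (ht : t₀ < t₁)
    (f : ℝ → M) (hf : MDifferentiableOn 𝓘(ℝ, ℝ) 𝓘(ℝ, E) f (Icc t₀ t₁))
    (p q : M) (v_p : TangentSpace 𝓘(ℝ, E) p) (v_q : TangentSpace 𝓘(ℝ, E) q)
    -- `f t₀ = p`, `f' t₀ = v_p`, `f t₁ = q`, `f' t₁ = v_q`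
    (hp : velocityWithin f (Icc t₀ t₁) t₀ = ⟨p, v_p⟩)
    (hq : velocityWithin f (Icc t₀ t₁) t₁ = ⟨q, v_q⟩)
    -- the open set on which `Exp_q` is inverted, and whose image contains `p`
    (D : Set (TangentSpace 𝓘(ℝ, E) q)) (hD : IsOpen D) (hDdom : D ⊆ expDomain q)
    (hDinj : InjOn (expMap q) D) (hpD : p ∈ expMap q '' D)
    -- `p` and `q` are not conjugate along the connecting geodesic
    (hconj : ¬ AreConjugateAlong E (fun t : ℝ ↦ expMap q (t • logMap q D p)) 0 1) :
    MDifferentiableAt 𝓘(ℝ, E) 𝓘(ℝ, E) (M' := E) (logMap q D) p ∧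
    -- the formula for the interpolating curve makes sense (automatic if `M` is complete)
    ((∀ t ∈ Icc t₀ t₁, tangentInterpolant t₀ t₁ p q D v_p v_q t ∈ expDomain q) →
      ContMDiffOn 𝓘(ℝ, ℝ) 𝓘(ℝ, E) 1 (hermiteCurve t₀ t₁ p q D v_p v_q) (Icc t₀ t₁) ∧
      hermiteCurve t₀ t₁ p q D v_p v_q t₀ = p ∧
      hermiteCurve t₀ t₁ p q D v_p v_q t₁ = q ∧
      velocityWithin (hermiteCurve t₀ t₁ p q D v_p v_q) (Icc t₀ t₁) t₀ = ⟨p, v_p⟩ ∧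
      velocityWithin (hermiteCurve t₀ t₁ p q D v_p v_q) (Icc t₀ t₁) t₁ = ⟨q, v_q⟩) := by
  obtain ⟨L, hL, hlog⟩ := hasMFDerivAt_modelLog (E := E) hD hDdom hDinj hpD hconj
  refine ⟨hlog.mdifferentiableAt, fun hdom ↦ ?_⟩
  let Δ : E := logMap q D p
  let v : E := dLog q D p v_p
  let w : E := v_q
  let P : ℝ → E := hermiteInterpolant t₀ t₁ Δ v w
  have hP₀ : P t₀ = Δ := hermiteInterpolant_left t₀ t₁ Δ v w
  have hP₁ : P t₁ = 0 := hermiteInterpolant_right ht.ne Δ v w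
  have hPdom : ∀ t ∈ Icc t₀ t₁, P t ∈ modelExpDomain q := hdom
  have hdexp₀ : fderiv ℝ (fun x : E ↦ chartAt E p (modelExp q x)) (P t₀) v = v_p := by
    rw [hP₀, show v = L.symm v_p from DFunLike.congr_fun hlog.mfderiv v_p]
    exact (DFunLike.congr_fun hL.symm _).trans (L.apply_symm_apply v_p)
  have hdexp₁ : fderiv ℝ (fun x : E ↦ chartAt E q (modelExp q x)) (P t₁) w = v_q := by
    rw [hP₁]
    exact fderiv_chart_modelExp_zero q w
  have hc₀ : modelExp q (P t₀) = p := hP₀ ▸ modelExp_modelLog hpD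
  have hc₁ : modelExp q (P t₁) = q := hP₁ ▸ modelExp_zero q
  have ht₀ : t₀ ∈ Icc t₀ t₁ := left_mem_Icc.2 ht.le
  have ht₁ : t₁ ∈ Icc t₀ t₁ := right_mem_Icc.2 ht.le
  refine ⟨fun t htI ↦ ?_, hc₀, hc₁, ?_, ?_⟩
  · exact ((contMDiffAt_modelExp (hPdom t htI)).comp t
      (contDiff_hermiteInterpolant t₀ t₁ Δ v w).contMDiff.contMDiffAt).contMDiffWithinAt
  · exact velocityWithin_modelExp_comp (uniqueDiffOn_Icc ht t₀ ht₀)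
      (hasDerivAt_hermiteInterpolant_left t₀ t₁ Δ v w) (hPdom t₀ ht₀) hc₀ hdexp₀
  · exact velocityWithin_modelExp_comp (uniqueDiffOn_Icc ht t₁ ht₁)
      (hasDerivAt_hermiteInterpolant_right ht.ne Δ v w) (hPdom t₁ ht₁) hc₁ hdexp₁
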